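/- Let $p\ge 1$ be an integer and let $\mu$ be a probability measure on $[0,\infty)$ with $\int_0^\infty t^p\,d\mu(t)<\infty$ and $\int_0^\infty t^{p+1}\,d\mu(t)=\infty$. Write $m_j$ and $\kappa_j$ ($j\le p$) for its moments and free cumulants, $G_\mu(z)=\int \frac{1}{z-t}\,d\mu(t)$ for its Cauchy transform on the upper half-plane, $F_\mu=1/G_\mu$, and $\phi_\mu(z)=F_\mu^{-1}(z)-z$ for its Voiculescu transform, where $F_\mu^{-1}$ is the inverse of $F_\mu$ near infinity, defined on $\{|\operatorname{Re} z|<\eta\operatorname{Im} z,\ |z|>M\}$ for every $\eta>0$ and some $M=M(\eta)$. Put $$r_G(z)=z^{p+1}\Big(G_\mu(z)-\sum_{j=1}^{p+1}m_{j-1}z^{-j}\Big),\qquad r_\phi(z)=z^{p-1}\Big(\phi_\mu(z)-\sum_{j=0}^{p-1}\kappa_{j+1}z^{-j}\Big).$$ A real function $f$, defined and measurable near $+\infty$, is regularly varying of index $\rho$ if $f(tx)/f(x)\to t^{\rho}$ as $x\to\infty$ for every $t>0$, and slowly varying if $\rho=0$. We write $f\ll g$, or $g\gg f$, if $f/g\to0$,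 and $f\sim g$ if $f/g\to1$; "$z\to\infty$ n.t." means that $z\to\infty$ inside $\{|\operatorname{Re} z|<\eta\operatorname{Im} z\}$, for each $\eta>0$. The following statements are equivalent: (i) $y\mapsto\mu(y,\infty)$ is regularly varying of index $-p$. (ii) $y\mapsto\operatorname{Im} r_G(iy)$ is slowly varying. (iii) $y\mapsto\operatorname{Im} r_\phi(iy)$ is slowly varying, $\operatorname{Re} r_\phi(iy)\gg y^{-1}$ as $y\to\infty$, and $r_\phi(z)\gg z^{-1}$ as $z\to\infty$ n.t. If any of these statements holds, then, as $z\to\infty$ n.t., $$r_G(z)\sim r_\phi(z)\gg z^{-1},$$ and, as $y\to\infty$, $$\operatorname{Im} r_\phi(iy)\sim\operatorname{Im} r_G(iy)\sim-\frac{p\pi}{2}\,y^p\mu(y,\infty)\gg\frac1y,\qquad \operatorname{Re} r_\phi(iy)\sim\operatorname{Re} r_G(iy)\gg\frac1y.$$ -/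

import Mathlib

open Filter Topology Asymptotics MeasureTheory

noncomputable section

namespace FreeTail

/-- A real function, defined at least on a neighbourhood of `+∞`, is regularly varying (at
infinity) of index `ρ` if it is measurable near `+∞` and `f (t x) / f x → t ^ ρ` as `x → ∞` for
every `t > 0`. (The limit being nonzero, `f` cannot vanish at arbitrarily large `x`.) -/
def RegularlyVarying (f : ℝ → ℝ) (ρ : ℝ) : Prop :=
  (∃ A : ℝ, Measurable (fun x : Set.Ioi A => f x)) ∧
    ∀ t : ℝ, 0 < t → Tendsto (fun x => f (t * x) / f x) atTop (𝓝 (t ^ ρ))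

/-- Slow variation is regular variation of index `0`. -/
def SlowlyVarying (f : ℝ → ℝ) : Prop := RegularlyVarying f 0

/-- The cone `{z : Im z > 0, |Re z| < η Im z}`. -/
def cone (η : ℝ) : Set ℂ := {z | 0 < z.im ∧ |z.re| < η * z.im}

/-- The truncated cone `{z : Im z > 0, |Re z| < η Im z, |z| > M}`. -/
def truncCone (η M : ℝ) : Set ℂ := {z | z ∈ cone η ∧ M < ‖z‖}

/-- The filter of `z → ∞` non-tangentially in the upper half-plane: a property holds eventually
along it if and only if for every `η > 0` it holds on `truncCone η M` for some `M`. -/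
def ntInfty : Filter ℂ := ⨆ (η : ℝ) (_ : 0 < η), Bornology.cobounded ℂ ⊓ 𝓟 (cone η)

/-- A probability measure on `[0, ∞)` whose moment of order `p` is finite and whose moment of
order `p + 1` is infinite. -/
structure IsInClass (p : ℕ) (μ : Measure ℝ) : Prop where
  isProbabilityMeasure : IsProbabilityMeasure μ
  supported : μ (Set.Iio 0) = 0
  moment_lt_top : ∫⁻ t, ENNReal.ofReal (t ^ p) ∂μ < ⊤
  moment_eq_top : ∫⁻ t, ENNReal.ofReal (t ^ (p + 1)) ∂μ = ⊤

/-- The tail `y ↦ μ (y, ∞)`. -/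
def tail (μ : Measure ℝ) (y : ℝ) : ℝ := μ.real (Set.Ioi y)

/-- The `j`-th moment. -/
def moment (μ : Measure ℝ) (j : ℕ) : ℝ := ∫ t, t ^ j ∂μ

/-- The free cumulants of a sequence `m` of moments (with `m 0 = 1`), given by the free
moment-cumulant formula
`m n = ∑_{s = 1}^{n} κ s * ∑_{i₁ + ⋯ + iₛ = n - s} m i₁ ⋯ m iₛ`, solved for `κ n`.
The inner sum is the coefficient of `X ^ (n - s)` in `(∑ i, m i X ^ i) ^ s`; for `s = n` it is `1`.
The value at `0` is irrelevant. -/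
def freeCumulantOf (m : ℕ → ℝ) : ℕ → ℝ
  | 0 => 0
  | n + 1 => m (n + 1) - ∑ s : Fin n,
      freeCumulantOf m (s.1 + 1) * PowerSeries.coeff (n - s.1) ((PowerSeries.mk m) ^ (s.1 + 1))
  decreasing_by exact Nat.succ_lt_succ s.2

/-- The `j`-th free cumulant of `μ`; it depends only on the moments of order at most `j`. -/
def freeCumulant (μ : Measure ℝ) (j : ℕ) : ℝ := freeCumulantOf (moment μ) j

/-- The Cauchy transform `G_μ`. -/
def cauchyTransform (μ : Measure ℝ) (z : ℂ) : ℂ := ∫ t : ℝ, 1 / (z - (t : ℂ)) ∂μ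

/-- The reciprocal Cauchy transform `F_μ = 1 / G_μ`. -/
def recipCauchy (μ : Measure ℝ) (z : ℂ) : ℂ := 1 / cauchyTransform μ z

/-- `g` is an inverse of `F_μ` near infinity: on every cone, far enough out, `g` is analytic with
values in the upper half-plane and is both a right and a left inverse of `F_μ`. Any two such `g`
agree on `truncCone η M` for every `η > 0` and all sufficiently large `M`. -/
def IsRecipCauchyInverse (μ : Measure ℝ) (g : ℂ → ℂ) : Prop :=
  ∀ η : ℝ, 0 < η → ∃ M : ℝ, 0 < M ∧
    DifferentiableOn ℂ g (truncCone η M) ∧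
    (∀ z ∈ truncCone η M, 0 < (g z).im ∧ recipCauchy μ (g z) = z) ∧
    (∀ z ∈ truncCone η M, g (recipCauchy μ z) = z)

open Classical in
/-- The inverse `F_μ⁻¹` near infinity (it exists for every probability measure `μ`). -/
def recipCauchyInverse (μ : Measure ℝ) : ℂ → ℂ :=
  if h : ∃ g : ℂ → ℂ, IsRecipCauchyInverse μ g then h.choose else 0

/-- The Voiculescu transform `φ_μ (z) = F_μ⁻¹ (z) - z`. -/
def voiculescu (μ : Measure ℝ) (z : ℂ) : ℂ := recipCauchyInverse μ z - z

/-- The remainder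
`r_G (z) = z ^ (p + 1) * (G_μ (z) - ∑_{j = 1}^{p + 1} m_{j - 1} z ^ (-j))`. -/
def remG (p : ℕ) (μ : Measure ℝ) (z : ℂ) : ℂ :=
  z ^ (p + 1) * (cauchyTransform μ z -
    ∑ j ∈ Finset.Icc 1 (p + 1), (moment μ (j - 1) : ℂ) * z ^ (-(j : ℤ)))

/-- The remainder
`r_φ (z) = z ^ (p - 1) * (φ_μ (z) - ∑_{j = 0}^{p - 1} κ_{j + 1} z ^ (-j))`. -/
def remPhi (p : ℕ) (μ : Measure ℝ) (z : ℂ) : ℂ :=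
  z ^ ((p : ℤ) - 1) * (voiculescu μ z -
    ∑ j ∈ Finset.range p, (freeCumulant μ (j + 1) : ℂ) * z ^ (-(j : ℤ)))

end FreeTail

end

/-! Write `I y = -Im r_G (iy)` (`tailTransform`) and `ℓ y = y ^ p μ (y, ∞)` (`scaledTail`).
Subtracting the first terms of the geometric expansion of `1 / (z - t)` gives `r_G (z) = ∫ t ^ (p +
1) / (z - t) dμ`, hence `I y = ∫ y t ^ (p + 1) / (y ^ 2 + t ^ 2) dμ`. As `y` grows, `y * I y`
increases to the infinite moment of order `p + 1`. So `I y ≫ 1 / y`, and `r_G (z) ≫ 1 / z` in every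
cone, with no regularity of the tail.

Passing from `r_G` to `r_φ` is equally unconditional: `r_φ - r_G = O(1 / z)` in each cone
(`IsInClass.isBigO_remPhi_sub_remG`). Put `w = F⁻¹ (z)`, `A = w G (w) = w / z`. Then `r_φ (z) = z ^
p (A - 1 - ∑ κ_s (A / w) ^ s)`, and `A` is the moment polynomial at `1 / w` plus `w ^ (-p) r_G (w)`.
The moment-cumulant formula cancels the polynomial part up to `O(z ^ (-p - 1))`, which leaves `r_G
(w) + O(1 / z)`, and `w - z` is bounded. Since `1 / z` is negligible against `r_G` and `1 / y`
against `Im r_G (iy)`, (ii) and (iii) agree up to the real-part condition. That condition follows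
from `-Re r_G (iy) ≥ ℓ y / 2` together with `I = O(ℓ)`, which (i) provides.

For (i) implies (ii), the layer-cake formula writes `I y` as an integral of `ℓ (y v)` against a
fixed kernel; Potter bounds and dominated convergence show that `I / ℓ` tends to a positive
constant. For the Tauberian converse, weight `μ` by the integrand of `I y`, normalise, and move it
to `[0, 1]` by `w = y ^ 2 / (y ^ 2 + t ^ 2)`. The Stieltjes transform of this law at `a` is `(1 + a)
^ (-1 / 2)` times `I (√(1 + a) y) / I y`, so slow variation makes it converge to that of the arcsine
law. The event `t > y` is `w < 1 / 2`, and integrating a suitable weight over it gives `ℓ / I → 2 /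
(π p)`. This also yields the constant of the theorem. -/

namespace FreeTail

/-! ### Integral formula for `r_G` and its consequences on the imaginary axis -/

variable {p : ℕ} {μ : Measure ℝ} {η : ℝ} {z : ℂ}

lemma IsInClass.ae_nonneg (hμ : IsInClass p μ) : ∀ᵐ t ∂μ, 0 ≤ t := by
  have h := hμ.supported
  rw [ae_iff]
  simpa [Set.Iio] using h

lemma IsInClass.integrable_pow_self (hμ : IsInClass p μ) : Integrable (fun t : ℝ => t ^ p) μ := by
  refine ⟨by fun_prop, ?_⟩
  rw [hasFiniteIntegral_iff_ofReal]
  · exact hμ.moment_lt_top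
  · filter_upwards [hμ.ae_nonneg] with t ht using pow_nonneg ht p

lemma IsInClass.integrable_pow (hμ : IsInClass p μ) {j : ℕ} (hj : j ≤ p) :
    Integrable (fun t : ℝ => t ^ j) μ := by
  have := hμ.isProbabilityMeasure
  refine ((integrable_const (1 : ℝ)).add hμ.integrable_pow_self).mono' (by fun_prop) ?_
  filter_upwards [hμ.ae_nonneg] with t ht
  rw [Real.norm_of_nonneg (pow_nonneg ht j)]
  simp only [Pi.add_apply]
  rcases le_total t 1 with h | h
  · linarith [pow_le_one₀ ht h (n := j), pow_nonneg ht p]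
  · linarith [pow_le_pow_right₀ h hj]

lemma im_le_norm_sub_ofReal (z : ℂ) (t : ℝ) : z.im ≤ ‖z - t‖ := by
  simpa using (le_abs_self _).trans (Complex.abs_im_le_norm (z - t))

lemma sub_ofReal_ne_zero (hz : 0 < z.im) (t : ℝ) : z - t ≠ 0 :=
  norm_pos_iff.1 (hz.trans_le (im_le_norm_sub_ofReal z t))

lemma norm_le_of_mem_cone (hz : z ∈ cone η) : ‖z‖ ≤ (1 + η) * z.im := by
  have h1 := Complex.norm_le_abs_re_add_abs_im z
  rw [abs_of_pos hz.1] at h1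
  linarith [hz.2]

lemma pos_of_mem_cone (hz : z ∈ cone η) : 0 < η := by
  by_contra h
  have := hz.2.trans_le (mul_nonpos_of_nonpos_of_nonneg (not_lt.1 h) hz.1.le)
  linarith [abs_nonneg z.re]

lemma ne_zero_of_mem_cone (hz : z ∈ cone η) : z ≠ 0 := by
  rintro rfl
  exact lt_irrefl _ hz.1

lemma norm_div_sub_ofReal_le (hz : z ∈ cone η) (t : ℝ) : ‖z / (z - t)‖ ≤ 1 + η := by
  rw [norm_div, div_le_iff₀ (norm_pos_iff.2 (sub_ofReal_ne_zero hz.1 t))]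
  exact (norm_le_of_mem_cone hz).trans (mul_le_mul_of_nonneg_left (im_le_norm_sub_ofReal z t)
    (by linarith [pos_of_mem_cone hz]))

/-- The bound is uniform in `t` and absorbs one power of `t`: this is why the moment of order `p`
controls an integrand containing `t ^ (p + 1)`. -/
lemma norm_ofReal_div_sub_le (hz : z ∈ cone η) (t : ℝ) : ‖(t : ℂ) / (z - t)‖ ≤ 2 + η := by
  have h : (t : ℂ) / (z - t) = z / (z - t) - 1 := by
    field_simp [sub_ofReal_ne_zero hz.1 t]
    ring
  rw [h]
  have := norm_sub_le (z / (z - t)) 1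
  rw [norm_one] at this
  linarith [norm_div_sub_ofReal_le hz t]

lemma exists_mem_cone (hz : 0 < z.im) : ∃ η, z ∈ cone η :=
  ⟨|z.re| / z.im + 1, hz, by rw [add_mul, div_mul_cancel₀ _ hz.ne']; linarith⟩

lemma IsInClass.integrable_pow_succ_div (hμ : IsInClass p μ) (hz : 0 < z.im) :
    Integrable (fun t : ℝ => (t : ℂ) ^ (p + 1) / (z - t)) μ := by
  obtain ⟨η, hη⟩ := exists_mem_cone hz
  refine (hμ.integrable_pow_self.norm.const_mul (2 + η)).mono'
    (Measurable.aestronglyMeasurable (by fun_prop)) (ae_of_all _ ?_)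
  intro t
  rw [pow_succ, mul_div_assoc, norm_mul, mul_comm]
  refine mul_le_mul (norm_ofReal_div_sub_le hη t) (by simp) (norm_nonneg _) ?_
  linarith [pos_of_mem_cone hη]

lemma integrable_cauchyKernel [IsFiniteMeasure μ] (hz : 0 < z.im) :
    Integrable (fun t : ℝ => 1 / (z - (t : ℂ))) μ := by
  refine (integrable_const (1 / z.im)).mono'
    (Measurable.aestronglyMeasurable (by fun_prop)) (ae_of_all _ fun t => ?_)
  rw [norm_div, norm_one]
  exact one_div_le_one_div_of_le hz (im_le_norm_sub_ofReal z t)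

lemma pow_mul_cauchyKernel_sub (n : ℕ) (hz : z ≠ 0) {x : ℂ} (hx : z - x ≠ 0) :
    z ^ n * (1 / (z - x) - ∑ j ∈ Finset.Icc 1 n, x ^ (j - 1) * z ^ (-(j : ℤ))) =
      x ^ n / (z - x) := by
  induction n with
  | zero => simp
  | succ n ih =>
    rw [Finset.sum_Icc_succ_top (by omega), ← sub_sub, mul_sub, pow_succ', mul_assoc, ih,
      zpow_neg, zpow_natCast, Nat.add_sub_cancel]
    field_simp
    ring

/-- The subtracted moments integrate the first `p + 1` terms of the geometric expansion of `1 / (z -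
t)` in powers of `t / z`, so only the closed-form remainder survives. -/
lemma IsInClass.remG_eq (hμ : IsInClass p μ) (hz : 0 < z.im) :
    remG p μ z = ∫ t : ℝ, (t : ℂ) ^ (p + 1) / (z - t) ∂μ := by
  have := hμ.isProbabilityMeasure
  have hz0 : z ≠ 0 := by rintro rfl; exact lt_irrefl _ hz
  have hint : ∀ j ∈ Finset.Icc 1 (p + 1),
      Integrable (fun t : ℝ => (t : ℂ) ^ (j - 1) * z ^ (-(j : ℤ))) μ := by
    intro j hj
    rw [Finset.mem_Icc] at hj
    have h := (hμ.integrable_pow (j := j - 1) (by omega)).ofReal (𝕜 := ℂ)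
    simp only [Complex.coe_algebraMap, RCLike.ofReal_pow] at h
    exact h.mul_const _
  have hsum : ∑ j ∈ Finset.Icc 1 (p + 1), (moment μ (j - 1) : ℂ) * z ^ (-(j : ℤ)) =
      ∫ t : ℝ, ∑ j ∈ Finset.Icc 1 (p + 1), (t : ℂ) ^ (j - 1) * z ^ (-(j : ℤ)) ∂μ := by
    rw [integral_finsetSum _ hint]
    refine Finset.sum_congr rfl fun j _ => ?_
    rw [integral_mul_const, moment, ← integral_complex_ofReal]
    simp
  rw [remG, cauchyTransform, hsum, ← integral_sub (integrable_cauchyKernel hz)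
    (integrable_finsetSum _ hint), ← integral_const_mul]
  exact integral_congr_ae (ae_of_all _ fun t => pow_mul_cauchyKernel_sub _ hz0
    (sub_ofReal_ne_zero hz t))

lemma measurable_cauchyTransform [SFinite μ] : Measurable (cauchyTransform μ) := by
  refine (StronglyMeasurable.integral_prod_right (f := fun (z : ℂ) (t : ℝ) => 1 / (z - (t : ℂ)))
    ?_).measurable
  exact (by fun_prop : Measurable fun x : ℂ × ℝ => 1 / (x.1 - (x.2 : ℂ))).stronglyMeasurable

lemma measurable_remG [SFinite μ] : Measurable (remG p μ) := by
  have := measurable_cauchyTransform (μ := μ)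
  unfold remG
  fun_prop

/-- The integrand of `-Im r_G (iy)`. -/
noncomputable def tailKernel (p : ℕ) (y t : ℝ) : ℝ := y * t ^ (p + 1) / (y ^ 2 + t ^ 2)

/-- The function `y ↦ -Im r_G (iy)`, as an integral. -/
noncomputable def tailTransform (p : ℕ) (μ : Measure ℝ) (y : ℝ) : ℝ := ∫ t, tailKernel p y t ∂μ

lemma tailKernel_nonneg {y t : ℝ} (hy : 0 ≤ y) (ht : 0 ≤ t) : 0 ≤ tailKernel p y t := by
  unfold tailKernel
  positivity

lemma IsInClass.integrable_tailKernel (hμ : IsInClass p μ) {y : ℝ} (hy : 0 < y) :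
    Integrable (tailKernel p y) μ := by
  refine hμ.integrable_pow_self.mono'
    (Measurable.aestronglyMeasurable (by unfold tailKernel; fun_prop)) ?_
  filter_upwards [hμ.ae_nonneg] with t ht
  rw [Real.norm_of_nonneg (tailKernel_nonneg hy.le ht), tailKernel,
    div_le_iff₀ (by positivity), pow_succ]
  have := pow_nonneg ht p
  nlinarith [mul_nonneg this (sq_nonneg (y - t)), mul_nonneg this (sq_nonneg y),
    mul_nonneg this (sq_nonneg t)]

lemma pow_div_I_mul_sub {y t : ℝ} (hy : 0 < y) (n : ℕ) : (t : ℂ) ^ n / (Complex.I * y - t) =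
    ((-(t ^ (n + 1) / (y ^ 2 + t ^ 2)) : ℝ) : ℂ) +
      ((-(y * t ^ n / (y ^ 2 + t ^ 2)) : ℝ) : ℂ) * Complex.I := by
  have h1 : Complex.I * y - t ≠ 0 := sub_ofReal_ne_zero (by simpa using hy) t
  have h2 : ((y : ℂ) ^ 2 + (t : ℂ) ^ 2) ≠ 0 := by
    exact_mod_cast (by positivity : y ^ 2 + t ^ 2 ≠ 0)
  push_cast
  field_simp
  ring_nf
  simp only [Complex.I_sq]
  ring

lemma re_pow_div_I_mul_sub {y t : ℝ} (hy : 0 < y) (n : ℕ) :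
    ((t : ℂ) ^ n / (Complex.I * y - t)).re = -(t ^ (n + 1) / (y ^ 2 + t ^ 2)) := by
  rw [pow_div_I_mul_sub hy, Complex.add_re, Complex.ofReal_re, Complex.re_ofReal_mul,
    Complex.I_re, mul_zero, add_zero]

lemma im_pow_div_I_mul_sub {y t : ℝ} (hy : 0 < y) (n : ℕ) :
    ((t : ℂ) ^ n / (Complex.I * y - t)).im = -(y * t ^ n / (y ^ 2 + t ^ 2)) := by
  rw [pow_div_I_mul_sub hy, Complex.add_im, Complex.ofReal_im, Complex.im_ofReal_mul,
    Complex.I_im, mul_one, zero_add]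

lemma IsInClass.im_remG (hμ : IsInClass p μ) {y : ℝ} (hy : 0 < y) :
    (remG p μ (Complex.I * y)).im = -tailTransform p μ y := by
  have hz : 0 < (Complex.I * (y : ℂ)).im := by simpa using hy
  rw [hμ.remG_eq hz, ← RCLike.im_eq_complex_im, ← integral_im (hμ.integrable_pow_succ_div hz),
    tailTransform, ← integral_neg]
  refine integral_congr_ae (ae_of_all _ fun t => im_pow_div_I_mul_sub hy _)

lemma IsInClass.re_remG (hμ : IsInClass p μ) {y : ℝ} (hy : 0 < y) :
    (remG p μ (Complex.I * y)).re = -∫ t, t ^ (p + 2) / (y ^ 2 + t ^ 2) ∂μ := by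
  have hz : 0 < (Complex.I * (y : ℂ)).im := by simpa using hy
  rw [hμ.remG_eq hz, ← RCLike.re_eq_complex_re, ← integral_re (hμ.integrable_pow_succ_div hz),
    ← integral_neg]
  refine integral_congr_ae (ae_of_all _ fun t => re_pow_div_I_mul_sub hy _)

lemma IsInClass.integrable_rePart (hμ : IsInClass p μ) {y : ℝ} (hy : 0 < y) :
    Integrable (fun t : ℝ => t ^ (p + 2) / (y ^ 2 + t ^ 2)) μ := by
  have hz : 0 < (Complex.I * (y : ℂ)).im := by simpa using hy
  refine (hμ.integrable_pow_succ_div hz).re.neg.congr (ae_of_all _ fun t => ?_)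
  exact (congrArg Neg.neg (re_pow_div_I_mul_sub hy _)).trans (neg_neg _)

/-- `-Re r_G (iy)` dominates half of `y ^ p μ (y, ∞)`. -/
lemma IsInClass.half_pow_mul_tail_le (hμ : IsInClass p μ) {y : ℝ} (hy : 0 < y) :
    y ^ p * tail μ y / 2 ≤ -(remG p μ (Complex.I * y)).re := by
  have := hμ.isProbabilityMeasure
  rw [hμ.re_remG hy, neg_neg]
  have h : ∫ t, (Set.Ioi y).indicator (fun _ => y ^ p / 2) t ∂μ = y ^ p * tail μ y / 2 := by
    rw [integral_indicator measurableSet_Ioi, setIntegral_const, smul_eq_mul, tail]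
    ring
  rw [← h]
  refine integral_mono_ae ((integrable_const _).indicator measurableSet_Ioi)
    (hμ.integrable_rePart hy) ?_
  filter_upwards [hμ.ae_nonneg] with t ht
  by_cases hty : y < t
  · rw [Set.indicator_of_mem (by exact hty), le_div_iff₀ (by positivity), pow_add]
    have h1 : y ^ p ≤ t ^ p := pow_le_pow_left₀ hy.le hty.le p
    have h2 : y ^ 2 + t ^ 2 ≤ 2 * t ^ 2 := by nlinarith
    calc y ^ p / 2 * (y ^ 2 + t ^ 2) ≤ t ^ p / 2 * (2 * t ^ 2) := by gcongr
      _ = _ := by ring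
  · rw [Set.indicator_of_notMem (by exact hty)]
    positivity

/-- `y * (-Im r_G (iy))` increases to the infinite moment of order `p + 1`. -/
lemma IsInClass.tendsto_mul_tailTransform (hμ : IsInClass p μ) :
    Tendsto (fun y => y * tailTransform p μ y) atTop atTop := by
  have hp1 : ∀ t : ℝ, 0 ≤ t → 0 ≤ t ^ (p + 1) := fun t ht => pow_nonneg ht _
  have key : ∀ y : ℝ, 0 < y → ENNReal.ofReal (y * tailTransform p μ y) =
      ∫⁻ t, ENNReal.ofReal (y * tailKernel p y t) ∂μ := by
    intro y hy
    rw [tailTransform, ← integral_const_mul, ofReal_integral_eq_lintegral_ofReal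
      ((hμ.integrable_tailKernel hy).const_mul y)]
    filter_upwards [hμ.ae_nonneg] with t ht using mul_nonneg hy.le (tailKernel_nonneg hy.le ht)
  have hmono : ∀ t : ℝ, 0 ≤ t → ∀ y y' : ℝ, 0 < y → y ≤ y' →
      y * tailKernel p y t ≤ y' * tailKernel p y' t := by
    intro t ht y y' hy hyy
    have hy' := hy.trans_le hyy
    unfold tailKernel
    rw [← mul_div_assoc, ← mul_div_assoc, div_le_div_iff₀ (by positivity) (by positivity)]
    have h1 : y ^ 2 ≤ y' ^ 2 := by gcongr
    have h2 := mul_le_mul_of_nonneg_left h1 (mul_nonneg (hp1 t ht) (sq_nonneg t))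
    nlinarith
  -- Monotone convergence along the positive integers; monotonicity in `y` then carries the
  -- divergence over to real `y`.
  have hlim : Tendsto (fun n : ℕ => ∫⁻ t, ENNReal.ofReal (((n : ℝ) + 1) *
      tailKernel p ((n : ℝ) + 1) t) ∂μ) atTop (𝓝 (∫⁻ t, ENNReal.ofReal (t ^ (p + 1)) ∂μ)) := by
    refine lintegral_tendsto_of_tendsto_of_monotone (fun n => ?_) ?_ ?_
    · unfold tailKernel; fun_prop
    · filter_upwards [hμ.ae_nonneg] with t ht
      intro n m hnm
      refine ENNReal.ofReal_le_ofReal (hmono t ht _ _ (by positivity) ?_)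
      have : (n : ℝ) ≤ m := by exact_mod_cast hnm
      linarith
    · refine ae_of_all _ fun t => (ENNReal.continuous_ofReal.tendsto _).comp ?_
      have h1 : Tendsto (fun n : ℕ => (((n : ℝ) + 1) ^ 2)) atTop atTop :=
        (tendsto_pow_atTop two_ne_zero).comp
          (tendsto_atTop_add_const_right _ _ tendsto_natCast_atTop_atTop)
      have h2 : Tendsto (fun n : ℕ => t ^ (p + 1) * (1 + t ^ 2 / ((n : ℝ) + 1) ^ 2)⁻¹) atTop
          (𝓝 (t ^ (p + 1) * (1 + 0)⁻¹)) :=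
        ((((tendsto_const_nhds).div_atTop h1).const_add 1).inv₀ (by norm_num)).const_mul _
      simp only [add_zero, inv_one, mul_one] at h2
      refine h2.congr fun n => ?_
      unfold tailKernel
      have : (0 : ℝ) < (n : ℝ) + 1 := by positivity
      field_simp
  rw [hμ.moment_eq_top] at hlim
  rw [tendsto_atTop]
  intro b
  have h1 := hlim.eventually (lt_mem_nhds (ENNReal.ofReal_lt_top (r := b)))
  obtain ⟨n, hn⟩ := h1.exists
  filter_upwards [eventually_ge_atTop ((n : ℝ) + 1)] with y hy
  have hn0 : (0 : ℝ) < (n : ℝ) + 1 := by positivity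
  have hy0 := hn0.trans_le hy
  rw [← key _ hn0] at hn
  by_contra hb
  rw [not_le] at hb
  have h2 : ((n : ℝ) + 1) * tailTransform p μ ((n : ℝ) + 1) ≤ y * tailTransform p μ y := by
    unfold tailTransform
    rw [← integral_const_mul, ← integral_const_mul]
    refine integral_mono_ae ((hμ.integrable_tailKernel hn0).const_mul _)
      ((hμ.integrable_tailKernel hy0).const_mul _) ?_
    filter_upwards [hμ.ae_nonneg] with t ht using hmono t ht _ _ hn0 hy
  exact absurd (ENNReal.ofReal_le_ofReal (h2.trans hb.le)) (not_le.2 hn)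

lemma IsInClass.eventually_tailTransform_pos (hμ : IsInClass p μ) :
    ∀ᶠ y in atTop, 0 < tailTransform p μ y := by
  filter_upwards [hμ.tendsto_mul_tailTransform.eventually_gt_atTop 0, eventually_gt_atTop 0]
    with y h hy using pos_of_mul_pos_right h hy.le

lemma IsInClass.inv_isLittleO_tailTransform (hμ : IsInClass p μ) :
    (fun y : ℝ => y⁻¹) =o[atTop] tailTransform p μ := by
  rw [isLittleO_iff_tendsto']
  · refine hμ.tendsto_mul_tailTransform.inv_tendsto_atTop.congr fun y => ?_
    simp [mul_comm, div_eq_mul_inv]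
  · filter_upwards [hμ.eventually_tailTransform_pos] with y hy h
    exact absurd h hy.ne'

lemma tail_antitone [IsFiniteMeasure μ] : Antitone (tail μ) := fun _ _ h =>
  measureReal_mono (Set.Ioi_subset_Ioi h)

/-- The tail never vanishes, the moment of order `p + 1` being infinite. -/
lemma IsInClass.tail_pos (hμ : IsInClass p μ) (y : ℝ) : 0 < tail μ y := by
  have := hμ.isProbabilityMeasure
  refine (measureReal_nonneg).lt_of_ne' fun h => ?_
  rw [measureReal_eq_zero_iff] at h
  have h1 : ∀ᵐ t ∂μ, t ≤ y := by
    rw [ae_iff]; simpa [Set.Ioi] using h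
  have h2 : ∫⁻ t, ENNReal.ofReal (t ^ (p + 1)) ∂μ ≤ ∫⁻ _, ENNReal.ofReal (y ^ (p + 1)) ∂μ := by
    refine lintegral_mono_ae ?_
    filter_upwards [h1, hμ.ae_nonneg] with t ht ht0
    exact ENNReal.ofReal_le_ofReal (pow_le_pow_left₀ ht0 ht _)
  rw [hμ.moment_eq_top, lintegral_const, measure_univ, mul_one] at h2
  exact absurd h2 (not_le.2 ENNReal.ofReal_lt_top)

end FreeTail

/-! ### Abelian half: Potter bounds and dominated convergence -/

namespace FreeTail

variable {p : ℕ} {μ : Measure ℝ}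

/-- The function `y ↦ y ^ p μ (y, ∞)`. -/
noncomputable def scaledTail (p : ℕ) (μ : Measure ℝ) (y : ℝ) : ℝ := y ^ p * tail μ y

lemma IsInClass.scaledTail_pos (hμ : IsInClass p μ) {y : ℝ} (hy : 0 < y) :
    0 < scaledTail p μ y := mul_pos (pow_pos hy p) (hμ.tail_pos y)

lemma measurable_scaledTail [IsFiniteMeasure μ] : Measurable (scaledTail p μ) :=
  (measurable_id.pow_const p).mul tail_antitone.measurable

lemma RegularlyVarying.tendsto_scaledTail (h : RegularlyVarying (tail μ) (-(p : ℝ)))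
    {t : ℝ} (ht : 0 < t) :
    Tendsto (fun y => scaledTail p μ (t * y) / scaledTail p μ y) atTop (𝓝 1) := by
  have h1 := (h.2 t ht).const_mul (t ^ p)
  rw [Real.rpow_neg ht.le, Real.rpow_natCast, mul_inv_cancel₀ (pow_pos ht p).ne'] at h1
  refine h1.congr' ?_
  filter_upwards [eventually_gt_atTop 0] with y hy
  have : y ^ p ≠ 0 := (pow_pos hy p).ne'
  rw [scaledTail, scaledTail, mul_pow, mul_assoc, mul_div_assoc, mul_div_mul_left _ _ this]

/-- Potter's bound for the function `y ^ p μ (y, ∞)`, away from the origin. -/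
lemma IsInClass.exists_potter (hμ : IsInClass p μ)
    (h : RegularlyVarying (tail μ) (-(p : ℝ))) :
    ∃ X, 0 < X ∧ ∀ y, X ≤ y → ∀ s, 1 ≤ s →
      scaledTail p μ (s * y) ≤ 2 ^ p * √s * scaledTail p μ y ∧
      scaledTail p μ y ≤ 2 ^ (p + 1) * √s * scaledTail p μ (s * y) := by
  have := hμ.isProbabilityMeasure
  -- Doubling the argument eventually changes `ℓ` by a factor at most `√2` either way. Iterated,
  -- this gives the power `s ^ (1 / 2)`; any exponent in `(0, 1)` would leave the later majorant
  -- integrable.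
  have hs2 : 1 < √(2 : ℝ) := by rw [Real.lt_sqrt] <;> norm_num
  have hs2' : √(2 : ℝ) < 2 := by rw [Real.sqrt_lt'] <;> norm_num
  have hlim := h.tendsto_scaledTail two_pos
  obtain ⟨X, hX⟩ := eventually_atTop.1 ((hlim.eventually_lt_const hs2).and
    (hlim.eventually_const_lt (inv_lt_one_of_one_lt₀ hs2)))
  refine ⟨max X 1, by positivity, fun y hy s hs => ?_⟩
  have hpow : ∀ k : ℕ, ∀ y, max X 1 ≤ y →
      scaledTail p μ (2 ^ k * y) ≤ √2 ^ k * scaledTail p μ y ∧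
      scaledTail p μ y ≤ √2 ^ k * scaledTail p μ (2 ^ k * y) := by
    intro k
    induction k with
    | zero => intro y _; simp
    | succ k ih =>
      intro y hy
      have hy0 : 0 < y := lt_of_lt_of_le (by positivity) hy
      have hk : (1 : ℝ) ≤ 2 ^ k := one_le_pow₀ (by norm_num)
      have hy' : y ≤ 2 ^ k * y := by nlinarith
      obtain ⟨h1, h2⟩ := hX (2 ^ k * y) ((le_max_left _ _).trans (hy.trans hy'))
      have hpos := hμ.scaledTail_pos (hy0.trans_le hy')
      rw [div_lt_iff₀ hpos] at h1
      rw [lt_div_iff₀ hpos, inv_mul_lt_iff₀ (by positivity)] at h2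
      obtain ⟨h3, h4⟩ := ih y hy
      have e : (2 : ℝ) ^ (k + 1) * y = 2 * (2 ^ k * y) := by ring
      rw [e, pow_succ' (√(2 : ℝ))]
      constructor
      · calc _ ≤ √2 * scaledTail p μ (2 ^ k * y) := h1.le
          _ ≤ √2 * (√2 ^ k * scaledTail p μ y) := by gcongr
          _ = _ := by ring
      · calc _ ≤ √2 ^ k * scaledTail p μ (2 ^ k * y) := h4
          _ ≤ √2 ^ k * (√2 * scaledTail p μ (2 * (2 ^ k * y))) := by gcongr
          _ = _ := by ring
  have hy0 : 0 < y := lt_of_lt_of_le (by positivity) hy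
  -- Between consecutive powers of two the monotonicity of the tail takes over, at the cost of the
  -- factor `2 ^ p` from `y ^ p`.
  obtain ⟨k, hk1, hk2⟩ := exists_nat_pow_near hs (by norm_num : (1 : ℝ) < 2)
  have hsq : √(2 : ℝ) ^ k ≤ √s := by
    refine Real.le_sqrt_of_sq_le ?_
    rwa [← pow_mul, mul_comm k, pow_mul, Real.sq_sqrt two_pos.le]
  have hT := tail_antitone (μ := μ)
  have hpos := fun x => (hμ.tail_pos x).le
  constructor
  · calc scaledTail p μ (s * y) = (s * y) ^ p * tail μ (s * y) := rfl
      _ ≤ (2 ^ (k + 1) * y) ^ p * tail μ (2 ^ k * y) := by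
        refine mul_le_mul ?_ (hT ?_) (hpos _) (by positivity) <;> gcongr
      _ = 2 ^ p * scaledTail p μ (2 ^ k * y) := by rw [scaledTail]; ring
      _ ≤ 2 ^ p * (√2 ^ k * scaledTail p μ y) := by gcongr; exact (hpow k y hy).1
      _ ≤ 2 ^ p * (√s * scaledTail p μ y) := by
        gcongr; exact (hμ.scaledTail_pos hy0).le
      _ = _ := by ring
  · calc scaledTail p μ y ≤ √2 ^ (k + 1) * scaledTail p μ (2 ^ (k + 1) * y) := (hpow (k + 1) y hy).2
      _ = √2 ^ (k + 1) * (2 ^ p * ((2 ^ k * y) ^ p * tail μ (2 ^ (k + 1) * y))) := by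
        rw [scaledTail]; ring
      _ ≤ √2 ^ (k + 1) * (2 ^ p * ((s * y) ^ p * tail μ (s * y))) := by
        gcongr
        · exact hpos _
        · refine hT ?_
          gcongr
      _ = 2 ^ p * √2 * √2 ^ k * scaledTail p μ (s * y) := by rw [scaledTail]; ring
      _ ≤ 2 ^ p * 2 * √s * scaledTail p μ (s * y) := by
        have := (hμ.scaledTail_pos (by positivity : 0 < s * y)).le
        gcongr
      _ = _ := by ring

/-- Potter's bound for the function `y ^ p μ (y, ∞)`, up to the origin. -/
lemma IsInClass.exists_scaledTail_le (hμ : IsInClass p μ)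
    (h : RegularlyVarying (tail μ) (-(p : ℝ))) :
    ∃ C X, 0 < C ∧ 0 < X ∧ ∀ y, X ≤ y → ∀ s, 0 < s →
      scaledTail p μ (y * s) ≤ C * (√s + (√s)⁻¹) * scaledTail p μ y := by
  have := hμ.isProbabilityMeasure
  obtain ⟨X, hX, hP⟩ := hμ.exists_potter h
  have hlX := hμ.scaledTail_pos hX
  set D := X ^ p / scaledTail p μ X with hD
  have hD0 : 0 < D := by positivity
  refine ⟨(D + 1) * 2 ^ (p + 1), X, by positivity, hX, fun y hy s hs => ?_⟩
  have hy0 := hX.trans_le hy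
  have hly := hμ.scaledTail_pos hy0
  have hsi : 0 < (√s)⁻¹ := by positivity
  have hss : 0 < √s := by positivity
  rcases le_total 1 s with h1 | h1
  · have := (hP y hy s h1).1
    rw [mul_comm y s]
    refine this.trans ?_
    rw [mul_assoc, mul_assoc, mul_assoc, ← mul_assoc (D + 1)]
    gcongr
    · rw [pow_succ]
      nlinarith [pow_pos (two_pos (α := ℝ)) p]
    · linarith
  · have key : scaledTail p μ (y * s) ≤ (D + 1) * 2 ^ (p + 1) * (√s)⁻¹ * scaledTail p μ y := by
      rcases le_total X (y * s) with h2 | h2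
      · have h3 := (hP (y * s) h2 s⁻¹ ((one_le_inv₀ hs).2 h1)).2
        rw [show s⁻¹ * (y * s) = y by field_simp, Real.sqrt_inv] at h3
        refine h3.trans ?_
        rw [mul_assoc (D + 1), mul_assoc (D + 1)]
        exact le_mul_of_one_le_left (by positivity) (by linarith)
      -- Below `X` Potter's bound fails, but the tail is at most `1`, so `ℓ (y s) ≤ X ^ p`. This is
      -- compared with `ℓ X` through `D`, and `ℓ X` with `ℓ y` by Potter; `y s ≤ X` turns `√(y / X)`
      -- into at most `(√s)⁻¹`.
      · have h3 := (hP X le_rfl (y / X) ((one_le_div hX).2 hy)).2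
        rw [div_mul_cancel₀ _ hX.ne'] at h3
        have h4 : √(y / X) ≤ (√s)⁻¹ := by
          rw [← Real.sqrt_inv]
          refine Real.sqrt_le_sqrt ?_
          rw [div_le_iff₀ hX, inv_mul_eq_div, le_div_iff₀ hs]
          exact h2
        have h5 : scaledTail p μ (y * s) ≤ D * scaledTail p μ X := by
          rw [hD, div_mul_cancel₀ _ hlX.ne', scaledTail]
          refine (mul_le_of_le_one_right (by positivity) measureReal_le_one).trans ?_
          gcongr
        calc _ ≤ D * scaledTail p μ X := h5
          _ ≤ D * (2 ^ (p + 1) * √(y / X) * scaledTail p μ y) := by gcongr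
          _ ≤ (D + 1) * (2 ^ (p + 1) * (√s)⁻¹ * scaledTail p μ y) := by
            gcongr
            linarith
          _ = _ := by ring
    refine key.trans ?_
    gcongr
    linarith

/-- The kernel that expresses `-Im r_G (iy)` through the tail. -/
noncomputable def layerKernel (p : ℕ) (v : ℝ) : ℝ := (p + 1 + (p - 1) * v ^ 2) / (1 + v ^ 2) ^ 2

lemma layerKernel_pos (hp : 1 ≤ p) (v : ℝ) : 0 < layerKernel p v := by
  have : (0 : ℝ) ≤ p - 1 := by simpa using hp
  unfold layerKernel
  positivity

lemma layerKernel_le (v : ℝ) : layerKernel p v ≤ (p + 1) * (1 + v ^ 2)⁻¹ := by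
  unfold layerKernel
  rw [← div_eq_mul_inv, div_le_div_iff₀ (by positivity) (by positivity)]
  have : (0 : ℝ) ≤ 1 + v ^ 2 := by positivity
  have h : ((p : ℝ) + 1 + (p - 1) * v ^ 2) ≤ (p + 1) * (1 + v ^ 2) := by nlinarith [sq_nonneg v]
  calc _ ≤ ((p : ℝ) + 1) * (1 + v ^ 2) * (1 + v ^ 2) := by gcongr
    _ = _ := by ring

lemma measurable_layerKernel : Measurable (layerKernel p) := by
  unfold layerKernel
  fun_prop

/-- This is where `layerKernel` comes from: after `t = y v`, the derivative is `v ^ p` times a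
kernel in `v` alone, up to a power of `y`. -/
lemma hasDerivAt_tailKernel {y : ℝ} (hy : 0 < y) (t : ℝ) :
    HasDerivAt (tailKernel p y) (t ^ p * layerKernel p (t / y) / y) t := by
  have h1 : HasDerivAt (fun t : ℝ => y * t ^ (p + 1)) (y * (((p + 1 : ℕ) : ℝ) * t ^ p)) t :=
    (hasDerivAt_pow (p + 1) t).const_mul y
  have h2 : HasDerivAt (fun t : ℝ => y ^ 2 + t ^ 2) (((2 : ℕ) : ℝ) * t ^ 1) t :=
    (hasDerivAt_pow 2 t).const_add _
  have h3 : y ^ 2 + t ^ 2 ≠ 0 := by positivity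
  refine (h1.div h2 h3).congr_deriv ?_
  unfold layerKernel
  push_cast
  field_simp
  ring

/-- Layer cake: `tailKernel p y` vanishes at `0` and is the integral of its nonnegative derivative,
so its `μ`-integral is that derivative integrated against the tail. The substitution `s = y v` then
makes the kernel independent of `y`. -/
lemma IsInClass.tailTransform_eq (hμ : IsInClass p μ) (hp : 1 ≤ p) {y : ℝ} (hy : 0 < y) :
    tailTransform p μ y = ∫ v in Set.Ioi 0, layerKernel p v * scaledTail p μ (y * v) := by
  have := hμ.isProbabilityMeasure
  have hK : ∀ s : ℝ, 0 ≤ s → 0 ≤ s ^ p * layerKernel p (s / y) / y := fun s hs => by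
    have := (layerKernel_pos hp (s / y)).le
    positivity
  have hcont : Continuous fun s : ℝ => s ^ p * layerKernel p (s / y) / y := by
    unfold layerKernel
    have : ∀ s : ℝ, (1 + (s / y) ^ 2) ^ 2 ≠ 0 := fun s => by positivity
    fun_prop (disch := simp [hy.ne', this])
  have hI : ∀ t : ℝ, ∫ s in (0 : ℝ)..t, s ^ p * layerKernel p (s / y) / y = tailKernel p y t := by
    intro t
    rw [intervalIntegral.integral_eq_sub_of_hasDerivAt
      (fun s _ => hasDerivAt_tailKernel hy s) (hcont.intervalIntegrable _ _)]
    simp [tailKernel]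
  have h1 := lintegral_comp_eq_lintegral_meas_lt_mul μ (f := fun t => t) hμ.ae_nonneg
    aemeasurable_id' (fun t _ => hcont.intervalIntegrable 0 t)
    ((ae_restrict_mem measurableSet_Ioi).mono fun s hs => hK s (le_of_lt hs))
  simp only [hI] at h1
  have h2 : tailTransform p μ y =
      ∫ s in Set.Ioi 0, tail μ s * (s ^ p * layerKernel p (s / y) / y) := by
    rw [tailTransform, integral_eq_lintegral_of_nonneg_ae, h1, integral_eq_lintegral_of_nonneg_ae]
    · congr 1
      refine lintegral_congr fun s => ?_
      rw [tail, ENNReal.ofReal_mul measureReal_nonneg, ofReal_measureReal]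
      rfl
    · refine (ae_restrict_mem measurableSet_Ioi).mono fun s hs => ?_
      exact mul_nonneg measureReal_nonneg (hK s (le_of_lt hs))
    · exact (tail_antitone.measurable.mul hcont.measurable).aestronglyMeasurable
    · exact hμ.ae_nonneg.mono fun t ht => tailKernel_nonneg hy.le ht
    · exact (hμ.integrable_tailKernel hy).aestronglyMeasurable
  have h3 := integral_comp_mul_left_Ioi
    (fun s => tail μ s * (s ^ p * layerKernel p (s / y) / y)) 0 hy
  rw [mul_zero, ← h2] at h3
  rw [← inv_smul_smul₀ (inv_ne_zero hy.ne') (tailTransform p μ y), ← h3, inv_inv, smul_eq_mul,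
    ← integral_const_mul]
  refine integral_congr_ae (ae_of_all _ fun v => ?_)
  simp only [scaledTail]
  rw [mul_div_cancel_left₀ _ hy.ne']
  field_simp

/-- The majorant for dominated convergence: Potter's factor times the decay of `layerKernel`. It
behaves like `v ^ (-1 / 2)` at the origin and `v ^ (-3 / 2)` at infinity. -/
lemma integrableOn_sqrt_add_inv_sqrt_mul :
    IntegrableOn (fun v : ℝ => (√v + (√v)⁻¹) * (1 + v ^ 2)⁻¹) (Set.Ioi 0) := by
  rw [← Set.Ioc_union_Ioi_eq_Ioi zero_le_one]
  have hm : Measurable (fun v : ℝ => (√v + (√v)⁻¹) * (1 + v ^ 2)⁻¹) := by fun_prop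
  refine IntegrableOn.union ?_ ?_
  · have h : IntegrableOn (fun v : ℝ => v ^ (-(1 / 2) : ℝ)) (Set.Ioc 0 1) :=
      (intervalIntegrable_iff_integrableOn_Ioc_of_le zero_le_one).1
        (intervalIntegral.intervalIntegrable_rpow' (by norm_num))
    refine (h.const_mul 2).mono' hm.aestronglyMeasurable ?_
    refine (ae_restrict_mem measurableSet_Ioc).mono fun v hv => ?_
    have hv0 : 0 < √v := Real.sqrt_pos.2 hv.1
    rw [Real.norm_of_nonneg (by positivity), Real.rpow_neg hv.1.le, ← Real.sqrt_eq_rpow]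
    have h1 : √v ≤ (√v)⁻¹ := by
      rw [le_inv_comm₀ hv0 hv0]
      have : √v ≤ 1 := Real.sqrt_le_one.2 hv.2
      exact this.trans ((one_le_inv₀ hv0).2 this)
    have h2 : (1 + v ^ 2)⁻¹ ≤ 1 := inv_le_one_of_one_le₀ (by nlinarith [sq_nonneg v])
    calc _ ≤ ((√v)⁻¹ + (√v)⁻¹) * 1 := by gcongr
      _ = _ := by ring
  · have h : IntegrableOn (fun v : ℝ => v ^ (-(3 / 2) : ℝ)) (Set.Ioi 1) :=
      integrableOn_Ioi_rpow_of_lt (by norm_num) one_pos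
    refine (h.const_mul 2).mono' hm.aestronglyMeasurable ?_
    refine (ae_restrict_mem measurableSet_Ioi).mono fun v hv => ?_
    have hv1 : (1 : ℝ) < v := hv
    have hvp : 0 < v := by linarith
    have hv0 : 0 < √v := Real.sqrt_pos.2 hvp
    rw [Real.norm_of_nonneg (by positivity)]
    have e : v ^ (-(3 / 2) : ℝ) = √v * (v ^ 2)⁻¹ := by
      rw [Real.sqrt_eq_rpow, ← Real.rpow_natCast, ← Real.rpow_neg hvp.le, ← Real.rpow_add hvp]
      norm_num
    rw [e]
    have h1 : (√v)⁻¹ ≤ √v := by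
      have : 1 ≤ √v := Real.one_le_sqrt.2 hv1.le
      exact (inv_le_one_of_one_le₀ this).trans this
    calc _ ≤ (√v + √v) * (v ^ 2)⁻¹ := by gcongr; linarith
      _ = _ := by ring

lemma integrable_layerKernel (hp : 1 ≤ p) : Integrable (layerKernel p) := by
  refine (integrable_inv_one_add_sq.const_mul ((p : ℝ) + 1)).mono'
    measurable_layerKernel.aestronglyMeasurable (ae_of_all _ fun v => ?_)
  rw [Real.norm_of_nonneg (layerKernel_pos hp v).le]
  exact layerKernel_le v

/-- The Abelian half: `-Im r_G (iy)` is asymptotic to a positive multiple of `y ^ p μ (y, ∞)`. -/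
lemma IsInClass.tendsto_tailTransform_div_scaledTail (hμ : IsInClass p μ) (hp : 1 ≤ p)
    (h : RegularlyVarying (tail μ) (-(p : ℝ))) :
    Tendsto (fun y => tailTransform p μ y / scaledTail p μ y) atTop
      (𝓝 (∫ v in Set.Ioi 0, layerKernel p v)) := by
  have := hμ.isProbabilityMeasure
  obtain ⟨C, X, hC, hX, hb⟩ := hμ.exists_scaledTail_le h
  have hlim : Tendsto (fun y => ∫ v in Set.Ioi 0,
      layerKernel p v * (scaledTail p μ (y * v) / scaledTail p μ y)) atTop
      (𝓝 (∫ v in Set.Ioi 0, layerKernel p v)) := by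
    refine tendsto_integral_filter_of_dominated_convergence
      (fun v => (p + 1) * C * ((√v + (√v)⁻¹) * (1 + v ^ 2)⁻¹)) ?_ ?_ ?_ ?_
    · refine Eventually.of_forall fun y => Measurable.aestronglyMeasurable ?_
      exact measurable_layerKernel.mul ((measurable_scaledTail.comp
        (measurable_id.const_mul y)).div_const _)
    · filter_upwards [eventually_ge_atTop X] with y hy
      refine (ae_restrict_mem measurableSet_Ioi).mono fun v hv => ?_
      have hv0 : (0 : ℝ) < v := hv
      have hy0 := hX.trans_le hy
      have h1 := hμ.scaledTail_pos hy0
      have h2 := hμ.scaledTail_pos (mul_pos hy0 hv0)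
      have h3 := layerKernel_pos hp v
      rw [Real.norm_of_nonneg (by positivity)]
      have h4 := hb y hy v hv0
      rw [← div_le_iff₀ h1] at h4
      calc _ ≤ ((p + 1) * (1 + v ^ 2)⁻¹) * (C * (√v + (√v)⁻¹)) := by
            gcongr
            exact layerKernel_le v
        _ = _ := by ring
    · exact integrableOn_sqrt_add_inv_sqrt_mul.const_mul _
    · refine (ae_restrict_mem measurableSet_Ioi).mono fun v hv => ?_
      have := (h.tendsto_scaledTail hv).const_mul (layerKernel p v)
      simpa only [mul_one, mul_comm v] using this
  refine hlim.congr' ?_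
  filter_upwards [eventually_gt_atTop 0] with y hy
  rw [hμ.tailTransform_eq hp hy, ← integral_div]
  simp only [mul_div_assoc]

lemma integral_layerKernel_pos (hp : 1 ≤ p) : 0 < ∫ v in Set.Ioi 0, layerKernel p v := by
  rw [setIntegral_pos_iff_support_of_nonneg_ae (ae_of_all _ fun v => (layerKernel_pos hp v).le)
    (integrable_layerKernel hp).integrableOn]
  have : Function.support (layerKernel p) = Set.univ :=
    Set.eq_univ_of_forall fun v => (layerKernel_pos hp v).ne'
  simp [this]

lemma IsInClass.tendsto_tailTransform_ratio (hμ : IsInClass p μ) (hp : 1 ≤ p)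
    (h : RegularlyVarying (tail μ) (-(p : ℝ))) {t : ℝ} (ht : 0 < t) :
    Tendsto (fun y => tailTransform p μ (t * y) / tailTransform p μ y) atTop (𝓝 1) := by
  have h1 := hμ.tendsto_tailTransform_div_scaledTail hp h
  have hc := (integral_layerKernel_pos hp).ne'
  have h2 := (h1.comp (tendsto_id.const_mul_atTop ht)).mul
    ((h.tendsto_scaledTail ht).mul (h1.inv₀ hc))
  rw [one_mul, mul_inv_cancel₀ hc] at h2
  refine h2.congr' ?_
  filter_upwards [eventually_gt_atTop 0] with y hy
  have h3 := (hμ.scaledTail_pos hy).ne'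
  have h4 := (hμ.scaledTail_pos (mul_pos ht hy)).ne'
  simp only [Function.comp_apply, id]
  field_simp

end FreeTail

/-! ### Continuity of probability measures on `[0, 1]` in their Stieltjes transforms -/

namespace FreeTail

section WeakConvergence

variable {ι : Type*} {l : Filter ι} {σ : ι → Measure ℝ} {ν : Measure ℝ} {f : ℝ → ℝ} {B : ℝ}

lemma integrable_of_bounded_unitInterval [IsFiniteMeasure ν]
    (hν : ∀ᵐ w ∂ν, w ∈ Set.Icc (0 : ℝ) 1) (hf : Measurable f)
    (hB : ∀ w ∈ Set.Icc (0 : ℝ) 1, |f w| ≤ B) : Integrable f ν :=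
  (integrable_const B).mono' hf.aestronglyMeasurable (hν.mono hB)

lemma abs_integral_sub_le [IsProbabilityMeasure ν] (hν : ∀ᵐ w ∂ν, w ∈ Set.Icc (0 : ℝ) 1)
    {g : ℝ → ℝ} {ε : ℝ} (hf : Integrable f ν) (hg : Integrable g ν)
    (h : ∀ w ∈ Set.Icc (0 : ℝ) 1, |f w - g w| ≤ ε) : |∫ w, f w ∂ν - ∫ w, g w ∂ν| ≤ ε := by
  rw [← integral_sub hf hg, ← Real.norm_eq_abs]
  simpa using norm_integral_le_of_norm_le_const (f := fun w => f w - g w) (hν.mono h)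

variable [∀ i, IsProbabilityMeasure (σ i)] [IsProbabilityMeasure ν]

lemma tendsto_integral_of_approx (hσ : ∀ i, ∀ᵐ w ∂σ i, w ∈ Set.Icc (0 : ℝ) 1)
    (hν : ∀ᵐ w ∂ν, w ∈ Set.Icc (0 : ℝ) 1) (hf : Measurable f)
    (hB : ∀ w ∈ Set.Icc (0 : ℝ) 1, |f w| ≤ B)
    (h : ∀ ε > 0, ∃ g : ℝ → ℝ, Measurable g ∧ (∀ w ∈ Set.Icc (0 : ℝ) 1, |f w - g w| ≤ ε) ∧
      Tendsto (fun i => ∫ w, g w ∂σ i) l (𝓝 (∫ w, g w ∂ν))) :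
    Tendsto (fun i => ∫ w, f w ∂σ i) l (𝓝 (∫ w, f w ∂ν)) := by
  rw [Metric.tendsto_nhds]
  intro ε hε
  obtain ⟨g, hgm, hfg, hg⟩ := h (ε / 3) (by positivity)
  have hgB : ∀ w ∈ Set.Icc (0 : ℝ) 1, |g w| ≤ B + ε / 3 := fun w hw => by
    have h1 := abs_sub_abs_le_abs_sub (g w) (f w)
    rw [abs_sub_comm (g w)] at h1
    linarith [hB w hw, hfg w hw]
  have key : ∀ (τ : Measure ℝ) [IsProbabilityMeasure τ], (∀ᵐ w ∂τ, w ∈ Set.Icc (0 : ℝ) 1) →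
      |∫ w, f w ∂τ - ∫ w, g w ∂τ| ≤ ε / 3 := fun τ _ hτ => abs_integral_sub_le hτ
    (integrable_of_bounded_unitInterval hτ hf hB) (integrable_of_bounded_unitInterval hτ hgm hgB)
    hfg
  filter_upwards [Metric.tendsto_nhds.1 hg (ε / 3) (by positivity)] with i hi
  rw [Real.dist_eq] at hi ⊢
  have h1 := abs_le.1 (key (σ i) (hσ i))
  have h2 := abs_le.1 (key ν hν)
  have h3 := abs_lt.1 hi
  rw [abs_lt]
  constructor <;> linarith

/-- Extracts the moments, which are the case `a = 0`. For `a > 0` the induction uses `w ^ (k + 1) /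
(1 + a w) = (w ^ k - w ^ k / (1 + a w)) / a`, which itself needs the moment of order `k`. -/
lemma tendsto_integral_pow_div (hσ : ∀ i, ∀ᵐ w ∂σ i, w ∈ Set.Icc (0 : ℝ) 1)
    (hν : ∀ᵐ w ∂ν, w ∈ Set.Icc (0 : ℝ) 1)
    (h : ∀ a : ℝ, 0 ≤ a → Tendsto (fun i => ∫ w, 1 / (1 + a * w) ∂σ i) l
      (𝓝 (∫ w, 1 / (1 + a * w) ∂ν))) (k : ℕ) :
    ∀ a : ℝ, 0 ≤ a → Tendsto (fun i => ∫ w, w ^ k / (1 + a * w) ∂σ i) l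
      (𝓝 (∫ w, w ^ k / (1 + a * w) ∂ν)) := by
  have hB : ∀ (k : ℕ) (a : ℝ), 0 ≤ a → ∀ w ∈ Set.Icc (0 : ℝ) 1,
      |w ^ k / (1 + a * w)| ≤ 1 := by
    intro k a ha w hw
    have h1 : 0 ≤ a * w := mul_nonneg ha hw.1
    rw [abs_of_nonneg (div_nonneg (pow_nonneg hw.1 k) (by linarith)),
      div_le_one (by linarith)]
    linarith [pow_le_one₀ hw.1 hw.2 (n := k)]
  have hm : ∀ (k : ℕ) (a : ℝ), Measurable fun w : ℝ => w ^ k / (1 + a * w) := by fun_prop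
  induction k with
  | zero => simpa using h
  | succ k ih =>
    have hpos : ∀ a : ℝ, 0 < a → Tendsto (fun i => ∫ w, w ^ (k + 1) / (1 + a * w) ∂σ i) l
        (𝓝 (∫ w, w ^ (k + 1) / (1 + a * w) ∂ν)) := by
      intro a ha
      have key : ∀ (τ : Measure ℝ) [IsProbabilityMeasure τ],
          (∀ᵐ w ∂τ, w ∈ Set.Icc (0 : ℝ) 1) → ∫ w, w ^ (k + 1) / (1 + a * w) ∂τ =
            (∫ w, w ^ k / (1 + 0 * w) ∂τ - ∫ w, w ^ k / (1 + a * w) ∂τ) / a := by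
        intro τ _ hτ
        rw [← integral_sub
          (integrable_of_bounded_unitInterval hτ (hm k 0) (hB k 0 le_rfl))
          (integrable_of_bounded_unitInterval hτ (hm k a) (hB k a ha.le)), ← integral_div]
        refine integral_congr_ae (hτ.mono fun w hw => ?_)
        have h1 : 0 ≤ a * w := mul_nonneg ha.le hw.1
        have h2 : 1 + a * w ≠ 0 := by linarith
        dsimp only
        field_simp
        ring
      rw [key ν hν]
      simp only [key _ (hσ _)]
      exact ((ih 0 le_rfl).sub (ih a ha.le)).div_const a
    intro a ha
    rcases ha.eq_or_lt with rfl | ha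
    -- The identity divides by `a`, so `a = 0` is reached by approximation: the parameter `ε`
    -- changes the integrand by at most `ε` on `[0, 1]`.
    · refine tendsto_integral_of_approx hσ hν (hm _ _) (hB _ _ le_rfl) fun ε hε =>
        ⟨_, hm (k + 1) ε, fun w hw => ?_, hpos ε hε⟩
      have h1 : 0 ≤ ε * w := mul_nonneg hε.le hw.1
      have h2 : w ^ (k + 1) / (1 + 0 * w) - w ^ (k + 1) / (1 + ε * w) =
          ε * w * (w ^ (k + 1) / (1 + ε * w)) := by
        have h2 : 1 + ε * w ≠ 0 := by linarith
        rw [zero_mul, add_zero, div_one]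
        field_simp
        ring
      rw [h2, abs_mul, abs_of_nonneg h1]
      refine (mul_le_of_le_one_right h1 (hB (k + 1) ε hε.le w hw)).trans ?_
      exact mul_le_of_le_one_right hε.le hw.2
    · exact hpos a ha

/-- A probability measure on `[0, 1]` depends continuously on its Stieltjes transform. -/
lemma tendsto_integral_of_stieltjes (hσ : ∀ i, ∀ᵐ w ∂σ i, w ∈ Set.Icc (0 : ℝ) 1)
    (hν : ∀ᵐ w ∂ν, w ∈ Set.Icc (0 : ℝ) 1)
    (h : ∀ a : ℝ, 0 ≤ a → Tendsto (fun i => ∫ w, 1 / (1 + a * w) ∂σ i) l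
      (𝓝 (∫ w, 1 / (1 + a * w) ∂ν))) (hf : Continuous f) :
    Tendsto (fun i => ∫ w, f w ∂σ i) l (𝓝 (∫ w, f w ∂ν)) := by
  have hpow : ∀ k : ℕ, Tendsto (fun i => ∫ w, w ^ k ∂σ i) l (𝓝 (∫ w, w ^ k ∂ν)) := fun k => by
    simpa using tendsto_integral_pow_div hσ hν h k 0 le_rfl
  have hint : ∀ (τ : Measure ℝ) [IsProbabilityMeasure τ],
      (∀ᵐ w ∂τ, w ∈ Set.Icc (0 : ℝ) 1) → ∀ (c : ℝ) (k : ℕ), Integrable (fun w => c * w ^ k) τ := by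
    intro τ _ hτ c k
    refine (integrable_of_bounded_unitInterval hτ (B := 1) (by fun_prop) fun w hw => ?_).const_mul c
    rw [abs_of_nonneg (pow_nonneg hw.1 k)]
    exact pow_le_one₀ hw.1 hw.2
  have hpoly : ∀ P : Polynomial ℝ, Tendsto (fun i => ∫ w, P.eval w ∂σ i) l
      (𝓝 (∫ w, P.eval w ∂ν)) := by
    intro P
    have key : ∀ (τ : Measure ℝ) [IsProbabilityMeasure τ],
        (∀ᵐ w ∂τ, w ∈ Set.Icc (0 : ℝ) 1) → ∫ w, P.eval w ∂τ =
          ∑ k ∈ Finset.range (P.natDegree + 1), P.coeff k * ∫ w, w ^ k ∂τ := by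
      intro τ _ hτ
      simp only [Polynomial.eval_eq_sum_range]
      rw [integral_finsetSum _ fun k _ => hint τ hτ _ k]
      simp only [integral_const_mul]
    rw [key ν hν]
    simp only [key _ (hσ _)]
    exact tendsto_finsetSum _ fun k _ => (hpow k).const_mul _
  obtain ⟨B, hB⟩ := isCompact_Icc.exists_bound_of_continuousOn (s := Set.Icc (0 : ℝ) 1)
    hf.continuousOn
  refine tendsto_integral_of_approx hσ hν hf.measurable hB fun ε hε => ?_
  obtain ⟨P, hP⟩ := exists_polynomial_near_of_continuousOn 0 1 f hf.continuousOn ε hε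
  refine ⟨fun w => P.eval w, P.continuous.measurable, fun w hw => ?_, hpoly P⟩
  rw [abs_sub_comm]
  exact (hP w hw).le

/-- A continuous cut-off that increases to `1` on `(-∞, 0)` when `b = 0`, and decreases to the
indicator of `(-∞, 0]` when `b = 1`. -/
noncomputable def cutoff (b : ℝ) (n : ℕ) (x : ℝ) : ℝ := max 0 (min 1 (b - n * x))

lemma cutoff_mem (b : ℝ) (n : ℕ) (x : ℝ) : cutoff b n x ∈ Set.Icc (0 : ℝ) 1 :=
  ⟨le_max_left _ _, max_le zero_le_one (min_le_left _ _)⟩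

lemma cutoff_zero_of_nonneg {n : ℕ} {x : ℝ} (hx : 0 ≤ x) : cutoff 0 n x = 0 := by
  have : 0 - n * x ≤ 0 := by linarith [mul_nonneg n.cast_nonneg hx]
  exact max_eq_left ((min_le_right _ _).trans this)

lemma cutoff_one_of_nonpos {n : ℕ} {x : ℝ} (hx : x ≤ 0) : cutoff 1 n x = 1 := by
  have : 1 ≤ 1 - n * x := by linarith [mul_nonpos_of_nonneg_of_nonpos n.cast_nonneg hx (α := ℝ)]
  rw [cutoff, min_eq_left this, max_eq_right zero_le_one]

lemma tendsto_cutoff (b : ℝ) {x : ℝ} (hx : x ≠ 0) :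
    Tendsto (fun n => cutoff b n x) atTop (𝓝 (if x < 0 then 1 else 0)) := by
  refine Tendsto.congr' ?_ tendsto_const_nhds
  rcases lt_or_gt_of_ne hx with h | h
  · have h1 : Tendsto (fun n : ℕ => (n : ℝ) * (-x)) atTop atTop :=
      tendsto_natCast_atTop_atTop.atTop_mul_const (by linarith)
    filter_upwards [h1.eventually_ge_atTop (1 - b)] with n hn
    rw [if_pos h, cutoff, min_eq_left (by linarith), max_eq_right zero_le_one]
  · have h1 : Tendsto (fun n : ℕ => (n : ℝ) * x) atTop atTop :=
      tendsto_natCast_atTop_atTop.atTop_mul_const h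
    filter_upwards [h1.eventually_ge_atTop b] with n hn
    rw [if_neg h.not_gt, cutoff, max_eq_left ((min_le_right _ _).trans (by linarith))]

lemma continuous_cutoff (b : ℝ) (n : ℕ) : Continuous (cutoff b n) := by
  unfold cutoff
  fun_prop

/-- The discontinuous integrand is squeezed between `f` times the two continuous cut-offs. As `c` is
not an atom of `ν`, both bounds have the same `ν`-integral in the limit. -/
lemma tendsto_integral_indicator_of_stieltjes (hσ : ∀ i, ∀ᵐ w ∂σ i, w ∈ Set.Icc (0 : ℝ) 1)
    (hν : ∀ᵐ w ∂ν, w ∈ Set.Icc (0 : ℝ) 1)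
    (h : ∀ a : ℝ, 0 ≤ a → Tendsto (fun i => ∫ w, 1 / (1 + a * w) ∂σ i) l
      (𝓝 (∫ w, 1 / (1 + a * w) ∂ν))) (hf : Continuous f) (hf0 : ∀ w, 0 ≤ f w) {c : ℝ}
    (hc : ν {c} = 0) :
    Tendsto (fun i => ∫ w, (Set.Iio c).indicator f w ∂σ i) l
      (𝓝 (∫ w, (Set.Iio c).indicator f w ∂ν)) := by
  obtain ⟨B, hB⟩ := isCompact_Icc.exists_bound_of_continuousOn (s := Set.Icc (0 : ℝ) 1)
    hf.continuousOn
  set g : ℝ → ℕ → ℝ → ℝ := fun b n w => f w * cutoff b n (w - c) with hg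
  have hgc : ∀ b n, Continuous (g b n) := fun b n =>
    hf.mul ((continuous_cutoff b n).comp (by fun_prop))
  have hgB : ∀ b n, ∀ w ∈ Set.Icc (0 : ℝ) 1, |g b n w| ≤ B := fun b n w hw => by
    have h1 := cutoff_mem b n (w - c)
    have h2 := hB w hw
    rw [hg, abs_mul, abs_of_nonneg h1.1]
    exact (mul_le_of_le_one_right (abs_nonneg _) h1.2).trans h2
  have hiB : ∀ w ∈ Set.Icc (0 : ℝ) 1, |(Set.Iio c).indicator f w| ≤ B := fun w hw =>
    (norm_indicator_le_norm_self f w).trans (hB w hw)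
  have him : Measurable ((Set.Iio c).indicator f) := hf.measurable.indicator measurableSet_Iio
  have hne : ∀ᵐ w ∂ν, w ≠ c := by
    rw [ae_iff]; simpa using hc
  have hlim : ∀ b, Tendsto (fun n => ∫ w, g b n w ∂ν) atTop
      (𝓝 (∫ w, (Set.Iio c).indicator f w ∂ν)) := by
    intro b
    refine tendsto_integral_of_dominated_convergence (fun _ => B)
      (fun n => (hgc b n).aestronglyMeasurable) (integrable_const B)
      (fun n => hν.mono (hgB b n)) (hne.mono fun w hw => ?_)
    have h1 := (tendsto_cutoff b (sub_ne_zero.2 hw)).const_mul (f w)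
    convert! h1 using 2
    by_cases hwc : w < c
    · simp [hwc]
    · simp [hwc]
  have hlo : ∀ n w, g 0 n w ≤ (Set.Iio c).indicator f w := by
    intro n w
    by_cases hwc : w < c
    · rw [Set.indicator_of_mem (by exact hwc)]
      exact mul_le_of_le_one_right (hf0 w) (cutoff_mem _ _ _).2
    · rw [Set.indicator_of_notMem (by exact hwc), hg]
      simp [cutoff_zero_of_nonneg (n := n) (sub_nonneg.2 (not_lt.1 hwc))]
  have hup : ∀ n w, (Set.Iio c).indicator f w ≤ g 1 n w := by
    intro n w
    by_cases hwc : w < c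
    · rw [Set.indicator_of_mem (by exact hwc), hg]
      simp [cutoff_one_of_nonpos (n := n) (sub_nonpos.2 hwc.le)]
    · rw [Set.indicator_of_notMem (by exact hwc)]
      exact mul_nonneg (hf0 w) (cutoff_mem _ _ _).1
  have hint := fun b n i => integrable_of_bounded_unitInterval (hσ i) (hgc b n).measurable (hgB b n)
  have hinti := fun i => integrable_of_bounded_unitInterval (hσ i) him hiB
  refine tendsto_order.2 ⟨fun a ha => ?_, fun a ha => ?_⟩
  · obtain ⟨n, hn⟩ := ((hlim 0).eventually (lt_mem_nhds ha)).exists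
    filter_upwards [(tendsto_integral_of_stieltjes hσ hν h (hgc 0 n)).eventually (lt_mem_nhds hn)]
      with i hi using hi.trans_le (integral_mono (hint 0 n i) (hinti i) (hlo n))
  · obtain ⟨n, hn⟩ := ((hlim 1).eventually (gt_mem_nhds ha)).exists
    filter_upwards [(tendsto_integral_of_stieltjes hσ hν h (hgc 1 n)).eventually (gt_mem_nhds hn)]
      with i hi using (integral_mono (hinti i) (hint 1 n i) (hup n)).trans_lt hi

end WeakConvergence

/-! ### Tauberian half: convergence to the arcsine law -/

variable {p : ℕ} {μ : Measure ℝ} {y : ℝ}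

/-- The normalised measure `tailKernel p y · μ`, transported to `[0, 1]` by
`t ↦ y ^ 2 / (y ^ 2 + t ^ 2)`. -/
noncomputable def tailLaw (p : ℕ) (μ : Measure ℝ) (y : ℝ) : Measure ℝ :=
  (μ.withDensity fun t => ENNReal.ofReal (tailKernel p y t / tailTransform p μ y)).map
    fun t => y ^ 2 / (y ^ 2 + t ^ 2)

/-- The arcsine law, as the image of the half-Cauchy law. -/
noncomputable def arcsineLaw : Measure ℝ :=
  ((volume.restrict (Set.Ioi 0)).withDensity
    fun s : ℝ => ENNReal.ofReal (2 / Real.pi * (1 + s ^ 2)⁻¹)).map fun s => (1 + s ^ 2)⁻¹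

lemma measurable_tailKernel : Measurable (tailKernel p y) := by
  unfold tailKernel
  fun_prop

lemma IsInClass.integral_tailLaw (hμ : IsInClass p μ) (hy : 0 < y)
    (hI : 0 < tailTransform p μ y) {f : ℝ → ℝ} (hf : Measurable f) :
    ∫ w, f w ∂tailLaw p μ y =
      (∫ t, tailKernel p y t * f (y ^ 2 / (y ^ 2 + t ^ 2)) ∂μ) / tailTransform p μ y := by
  have hm := measurable_tailKernel (p := p) (y := y)
  rw [tailLaw, integral_map (Measurable.aemeasurable (by fun_prop)) hf.aestronglyMeasurable,
    integral_withDensity_eq_integral_toReal_smul (by fun_prop)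
      (ae_of_all _ fun _ => ENNReal.ofReal_lt_top), ← integral_div]
  refine integral_congr_ae (hμ.ae_nonneg.mono fun t ht => ?_)
  have := tailKernel_nonneg (p := p) hy.le ht
  dsimp only
  rw [ENNReal.toReal_ofReal (by positivity), smul_eq_mul]
  ring

lemma IsInClass.isProbabilityMeasure_tailLaw (hμ : IsInClass p μ) (hy : 0 < y)
    (hI : 0 < tailTransform p μ y) : IsProbabilityMeasure (tailLaw p μ y) := by
  have : IsProbabilityMeasure
      (μ.withDensity fun t => ENNReal.ofReal (tailKernel p y t / tailTransform p μ y)) := by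
    constructor
    rw [withDensity_apply _ MeasurableSet.univ, Measure.restrict_univ,
      ← ofReal_integral_eq_lintegral_ofReal ((hμ.integrable_tailKernel hy).div_const _),
      integral_div, ← tailTransform, div_self hI.ne', ENNReal.ofReal_one]
    filter_upwards [hμ.ae_nonneg] with t ht
    exact div_nonneg (tailKernel_nonneg hy.le ht) hI.le
  exact Measure.isProbabilityMeasure_map (Measurable.aemeasurable (by fun_prop))

lemma ae_mem_tailLaw (hy : 0 < y) : ∀ᵐ w ∂tailLaw p μ y, w ∈ Set.Icc (0 : ℝ) 1 := by
  rw [tailLaw, ae_map_iff (p := fun w => w ∈ Set.Icc (0 : ℝ) 1)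
    (Measurable.aemeasurable (by fun_prop)) measurableSet_Icc]
  refine ae_of_all _ fun t => ⟨by positivity, ?_⟩
  rw [div_le_one (by positivity)]
  nlinarith [sq_nonneg t]

lemma integral_arcsineLaw {f : ℝ → ℝ} (hf : Measurable f) :
    ∫ w, f w ∂arcsineLaw =
      2 / Real.pi * ∫ s in Set.Ioi (0 : ℝ), (1 + s ^ 2)⁻¹ * f ((1 + s ^ 2)⁻¹) := by
  rw [arcsineLaw, integral_map (Measurable.aemeasurable (by fun_prop)) hf.aestronglyMeasurable,
    integral_withDensity_eq_integral_toReal_smul (by fun_prop)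
      (ae_of_all _ fun _ => ENNReal.ofReal_lt_top), ← integral_const_mul]
  refine integral_congr_ae (ae_of_all _ fun s => ?_)
  have := Real.pi_pos
  dsimp only
  rw [ENNReal.toReal_ofReal (by positivity), smul_eq_mul, mul_assoc]

lemma ae_mem_arcsineLaw : ∀ᵐ w ∂arcsineLaw, w ∈ Set.Icc (0 : ℝ) 1 := by
  rw [arcsineLaw, ae_map_iff (p := fun w => w ∈ Set.Icc (0 : ℝ) 1)
    (Measurable.aemeasurable (by fun_prop)) measurableSet_Icc]
  refine ae_of_all _ fun t => ⟨by positivity, ?_⟩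
  exact inv_le_one_of_one_le₀ (by nlinarith [sq_nonneg t])

instance : IsProbabilityMeasure arcsineLaw := by
  have hpi := Real.pi_pos
  have : IsProbabilityMeasure ((volume.restrict (Set.Ioi 0)).withDensity
      fun s : ℝ => ENNReal.ofReal (2 / Real.pi * (1 + s ^ 2)⁻¹)) := by
    constructor
    rw [withDensity_apply _ MeasurableSet.univ, Measure.restrict_univ,
      ← ofReal_integral_eq_lintegral_ofReal (integrable_inv_one_add_sq.integrableOn.const_mul _),
      integral_const_mul, integral_Ioi_inv_one_add_sq, Real.arctan_zero]
    · rw [sub_zero, div_mul_div_comm, mul_comm, div_self (by positivity), ENNReal.ofReal_one]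
    · exact ae_of_all _ fun s => by positivity
  exact Measure.isProbabilityMeasure_map (Measurable.aemeasurable (by fun_prop))

lemma arcsineLaw_half : arcsineLaw {1 / 2} = 0 := by
  rw [arcsineLaw, Measure.map_apply (by fun_prop) (measurableSet_singleton _)]
  refine withDensity_absolutelyContinuous _ _ ?_
  refine measure_mono_null (t := {1, -1}) (fun s hs => ?_) ?_
  · simp only [Set.mem_preimage, Set.mem_singleton_iff] at hs
    rw [inv_eq_iff_eq_inv] at hs
    have : s ^ 2 = 1 := by norm_num at hs; linarith
    rcases mul_eq_zero.1 (by linarith : (s - 1) * (s + 1) = 0) with h | h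
    · exact Or.inl (by linarith)
    · exact Or.inr (by rw [Set.mem_singleton_iff]; linarith)
  · exact ((Set.finite_singleton _).insert _).measure_zero _

lemma integral_stieltjes_arcsineLaw {a : ℝ} (ha : 0 ≤ a) :
    ∫ w, 1 / (1 + a * w) ∂arcsineLaw = (√(1 + a))⁻¹ := by
  have hpi := Real.pi_pos
  set x := √(1 + a) with hx
  have hx0 : 0 < x := Real.sqrt_pos.2 (by linarith)
  have hx2 : x ^ 2 = 1 + a := Real.sq_sqrt (by linarith)
  rw [integral_arcsineLaw (by fun_prop)]
  have h1 : ∀ s : ℝ, (1 + s ^ 2)⁻¹ * (1 / (1 + a * (1 + s ^ 2)⁻¹)) =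
      (x ^ 2)⁻¹ * (1 + (x⁻¹ * s) ^ 2)⁻¹ := by
    intro s
    have e : 1 + s ^ 2 + a = x ^ 2 + s ^ 2 := by rw [hx2]; ring
    have e2 : x ^ 2 + s ^ 2 ≠ 0 := by positivity
    field_simp
    rw [e]
  simp only [h1]
  rw [integral_const_mul, integral_comp_mul_left_Ioi (fun s => (1 + s ^ 2)⁻¹) 0 (inv_pos.2 hx0),
    mul_zero, integral_Ioi_inv_one_add_sq, Real.arctan_zero, inv_inv, smul_eq_mul]
  field_simp
  ring

/-- With `w = y ^ 2 / (y ^ 2 + t ^ 2)`, dividing by `1 + a w` replaces the denominator `y ^ 2 + t ^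
2` by `(1 + a) y ^ 2 + t ^ 2`, that is, rescales `y` by `√(1 + a)`. Slow variation thus becomes
convergence of Stieltjes transforms. -/
lemma IsInClass.integral_stieltjes_tailLaw (hμ : IsInClass p μ) (hy : 0 < y)
    (hI : 0 < tailTransform p μ y) {a : ℝ} (ha : 0 ≤ a) :
    ∫ w, 1 / (1 + a * w) ∂tailLaw p μ y =
      (√(1 + a))⁻¹ * (tailTransform p μ (√(1 + a) * y) / tailTransform p μ y) := by
  set x := √(1 + a) with hx
  have hx0 : 0 < x := Real.sqrt_pos.2 (by linarith)
  have hx2 : x ^ 2 = 1 + a := Real.sq_sqrt (by linarith)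
  rw [hμ.integral_tailLaw hy hI (by fun_prop), ← mul_div_assoc]
  congr 1
  unfold tailTransform
  rw [← integral_const_mul]
  refine integral_congr_ae (ae_of_all _ fun t => ?_)
  have e2 : (1 + a) * y ^ 2 + t ^ 2 ≠ 0 := by positivity
  have e3 : y ^ 2 + t ^ 2 ≠ 0 := by positivity
  have e4 : 1 + a * (y ^ 2 / (y ^ 2 + t ^ 2)) = ((1 + a) * y ^ 2 + t ^ 2) / (y ^ 2 + t ^ 2) := by
    field_simp
    ring
  simp only [tailKernel]
  rw [e4, mul_pow, hx2]
  field_simp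

/-- A continuous function on `ℝ` that on `{w | 0 ≤ w < 1 / 2}` is
`w ^ ((p - 1) / 2) * (1 - w) ^ (-(p + 1) / 2)`. -/
noncomputable def tailWeight (p : ℕ) (w : ℝ) : ℝ := √w ^ (p - 1) / √(max (1 - w) (1 / 2)) ^ (p + 1)

lemma continuous_tailWeight : Continuous (tailWeight p) := by
  unfold tailWeight
  have : ∀ w : ℝ, √(max (1 - w) (1 / 2)) ^ (p + 1) ≠ 0 := fun w => by positivity
  fun_prop (disch := exact this)

lemma tailWeight_eq (hp : 1 ≤ p) {y t : ℝ} (hy : 0 < y) (ht : y < t) :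
    tailWeight p (y ^ 2 / (y ^ 2 + t ^ 2)) = y ^ (p - 1) * (y ^ 2 + t ^ 2) / t ^ (p + 1) := by
  have ht0 := hy.trans ht
  have hr : 0 < y ^ 2 + t ^ 2 := by positivity
  have h1 : 1 - y ^ 2 / (y ^ 2 + t ^ 2) = t ^ 2 / (y ^ 2 + t ^ 2) := by
    field_simp
    ring
  have h2 : 1 / 2 ≤ t ^ 2 / (y ^ 2 + t ^ 2) := by
    rw [div_le_div_iff₀ two_pos hr]
    nlinarith
  have h3 : √(y ^ 2 + t ^ 2) ^ (p + 1) = √(y ^ 2 + t ^ 2) ^ (p - 1) * (y ^ 2 + t ^ 2) := by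
    obtain ⟨q, rfl⟩ := Nat.exists_eq_add_of_le' hp
    rw [show q + 1 + 1 = q + 2 from rfl, pow_add, Real.sq_sqrt hr.le, Nat.add_sub_cancel]
  rw [tailWeight, h1, max_eq_left h2, Real.sqrt_div (by positivity), Real.sqrt_div (by positivity),
    Real.sqrt_sq hy.le, Real.sqrt_sq ht0.le, div_pow, div_pow, h3]
  have : √(y ^ 2 + t ^ 2) ≠ 0 := (Real.sqrt_pos.2 hr).ne'
  field_simp

lemma half_lt_iff {y t : ℝ} (hy : 0 < y) (ht : 0 ≤ t) :
    y ^ 2 / (y ^ 2 + t ^ 2) < 1 / 2 ↔ y < t := by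
  rw [div_lt_div_iff₀ (by positivity) two_pos, ← pow_lt_pow_iff_left₀ hy.le ht two_ne_zero]
  constructor <;> intro h <;> linarith

/-- The weight is chosen so that its product with `tailKernel p y` is the constant `y ^ p` on `t >
y`, which is the event `w < 1 / 2`. -/
lemma IsInClass.integral_tailWeight_tailLaw (hμ : IsInClass p μ) (hp : 1 ≤ p) (hy : 0 < y)
    (hI : 0 < tailTransform p μ y) :
    ∫ w, (Set.Iio (1 / 2)).indicator (tailWeight p) w ∂tailLaw p μ y =
      scaledTail p μ y / tailTransform p μ y := by
  rw [hμ.integral_tailLaw hy hI (continuous_tailWeight.measurable.indicator measurableSet_Iio)]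
  congr 1
  have h : ∫ t, (Set.Ioi y).indicator (fun _ => y ^ p) t ∂μ = scaledTail p μ y := by
    rw [integral_indicator measurableSet_Ioi, setIntegral_const, smul_eq_mul, scaledTail, tail,
      mul_comm]
  rw [← h]
  refine integral_congr_ae (hμ.ae_nonneg.mono fun t ht => ?_)
  by_cases hty : y < t
  · have ht0 := hy.trans hty
    dsimp only
    rw [Set.indicator_of_mem (by exact (half_lt_iff hy ht).2 hty),
      Set.indicator_of_mem (by exact hty), tailWeight_eq hp hy hty, tailKernel]
    obtain ⟨q, rfl⟩ := Nat.exists_eq_add_of_le' hp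
    rw [Nat.add_sub_cancel]
    field_simp
    ring
  · dsimp only
    rw [Set.indicator_of_notMem (by exact fun hh => hty ((half_lt_iff hy ht).1 hh)),
      Set.indicator_of_notMem (by exact hty), mul_zero]

/-- In the half-Cauchy variable the integral is `2 / π` times `∫ s ^ (-p - 1)` over `s > 1`; this is
the source of the constant `p π / 2`. -/
lemma integral_tailWeight_arcsineLaw (hp : 1 ≤ p) :
    ∫ w, (Set.Iio (1 / 2)).indicator (tailWeight p) w ∂arcsineLaw = 2 / (Real.pi * p) := by
  have hpi := Real.pi_pos
  have hp0 : (0 : ℝ) < p := by exact_mod_cast hp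
  rw [integral_arcsineLaw (continuous_tailWeight.measurable.indicator measurableSet_Iio)]
  have h1 : ∀ s ∈ Set.Ioi (0 : ℝ), (1 + s ^ 2)⁻¹ *
      (Set.Iio (1 / 2)).indicator (tailWeight p) ((1 + s ^ 2)⁻¹) =
      (Set.Ioi (1 : ℝ)).indicator (fun s => s ^ (-((p : ℝ) + 1))) s := by
    intro s hs
    have hs0 : (0 : ℝ) < s := hs
    have e : (1 + s ^ 2)⁻¹ = 1 ^ 2 / (1 ^ 2 + s ^ 2) := by simp
    by_cases h1s : 1 < s
    · rw [e, Set.indicator_of_mem (by exact (half_lt_iff one_pos hs0.le).2 h1s),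
        Set.indicator_of_mem (by exact h1s), tailWeight_eq hp one_pos h1s, Real.rpow_neg hs0.le]
      rw [show (p : ℝ) + 1 = ((p + 1 : ℕ) : ℝ) by push_cast; rfl, Real.rpow_natCast]
      field_simp
      simp
    · rw [e, Set.indicator_of_notMem (by exact fun hh => h1s ((half_lt_iff one_pos hs0.le).1 hh)),
        Set.indicator_of_notMem (by exact h1s), mul_zero]
  rw [setIntegral_congr_fun measurableSet_Ioi h1, setIntegral_indicator measurableSet_Ioi,
    Set.inter_eq_self_of_subset_right (Set.Ioi_subset_Ioi zero_le_one),
    integral_Ioi_rpow_of_lt (by linarith) one_pos, Real.one_rpow]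
  have : -((p : ℝ) + 1) + 1 = -p := by ring
  rw [this]
  field_simp

/-- The Tauberian half: if `-Im r_G (iy)` varies slowly then `y ^ p μ (y, ∞)` is asymptotic to
`2 / (π p)` times it. -/
lemma IsInClass.tendsto_scaledTail_div_tailTransform (hμ : IsInClass p μ) (hp : 1 ≤ p)
    (h : ∀ t : ℝ, 0 < t →
      Tendsto (fun y => tailTransform p μ (t * y) / tailTransform p μ y) atTop (𝓝 1)) :
    Tendsto (fun y => scaledTail p μ y / tailTransform p μ y) atTop
      (𝓝 (2 / (Real.pi * p))) := by
  obtain ⟨Y, hY⟩ := eventually_atTop.1 (hμ.eventually_tailTransform_pos.and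
    (eventually_gt_atTop 0))
  -- The weak convergence lemma wants a probability measure at every index, so values of `y` below
  -- `Y` are replaced by `Y`.
  have hY' := fun y : ℝ => hY (max y Y) (le_max_right _ _)
  have hmax : ∀ᶠ y in atTop, max y Y = y := by
    filter_upwards [eventually_ge_atTop Y] with y hy using max_eq_left hy
  have : ∀ y, IsProbabilityMeasure (tailLaw p μ (max y Y)) := fun y =>
    hμ.isProbabilityMeasure_tailLaw (hY' y).2 (hY' y).1
  have key := tendsto_integral_indicator_of_stieltjes (l := atTop) (ν := arcsineLaw)
    (σ := fun y => tailLaw p μ (max y Y)) (c := 1 / 2)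
    (fun y => ae_mem_tailLaw (hY' y).2) ae_mem_arcsineLaw ?_ (continuous_tailWeight (p := p))
    (fun w => by unfold tailWeight; positivity) arcsineLaw_half
  · rw [integral_tailWeight_arcsineLaw hp] at key
    refine key.congr' (hmax.mono fun y hy => ?_)
    rw [hμ.integral_tailWeight_tailLaw hp (hY' y).2 (hY' y).1, hy]
  · intro a ha
    have h1 := (h (√(1 + a)) (Real.sqrt_pos.2 (by linarith))).const_mul (√(1 + a))⁻¹
    rw [mul_one] at h1
    rw [integral_stieltjes_arcsineLaw ha]
    refine h1.congr' (hmax.mono fun y hy => ?_)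
    dsimp only
    rw [hμ.integral_stieltjes_tailLaw (hY' y).2 (hY' y).1 ha, hy]

lemma IsInClass.regularlyVarying_tail (hμ : IsInClass p μ) (hp : 1 ≤ p)
    (h : ∀ t : ℝ, 0 < t →
      Tendsto (fun y => tailTransform p μ (t * y) / tailTransform p μ y) atTop (𝓝 1)) :
    RegularlyVarying (tail μ) (-(p : ℝ)) := by
  have := hμ.isProbabilityMeasure
  refine ⟨⟨0, tail_antitone.measurable.comp measurable_subtype_coe⟩, fun t ht => ?_⟩
  have h1 := hμ.tendsto_scaledTail_div_tailTransform hp h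
  have hc : 2 / (Real.pi * p) ≠ 0 := by
    have : (0 : ℝ) < p := by exact_mod_cast hp
    have := Real.pi_pos
    positivity
  have h2 := ((h1.comp (tendsto_id.const_mul_atTop ht)).mul
    ((h t ht).mul (h1.inv₀ hc))).const_mul (t ^ (-(p : ℝ)))
  rw [one_mul, mul_inv_cancel₀ hc, mul_one] at h2
  refine h2.congr' ?_
  filter_upwards [eventually_gt_atTop 0, hμ.eventually_tailTransform_pos,
    (tendsto_id.const_mul_atTop ht).eventually hμ.eventually_tailTransform_pos] with y hy h3 h4
  simp only [id] at h4
  have h5 := (hμ.tail_pos y).ne'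
  simp only [Function.comp_apply, id, scaledTail]
  rw [Real.rpow_neg ht.le, Real.rpow_natCast]
  field_simp
  ring

end FreeTail

/-! ### The inverse of the reciprocal Cauchy transform near infinity -/

namespace FreeTail

variable {p : ℕ} {μ : Measure ℝ} {η : ℝ} {z w : ℂ}

/-- The filter of `z → ∞` inside one cone. -/
noncomputable def coneInfty (η : ℝ) : Filter ℂ := Bornology.cobounded ℂ ⊓ 𝓟 (cone η)

lemma eventually_coneInfty {P : ℂ → Prop} :
    (∀ᶠ z in coneInfty η, P z) ↔ ∃ M, 0 < M ∧ ∀ z ∈ truncCone η M, P z := by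
  rw [coneInfty, eventually_inf_principal, ← comap_norm_atTop, eventually_comap]
  constructor
  · intro h
    obtain ⟨M, hM⟩ := eventually_atTop.1 h
    exact ⟨max M 1, by positivity, fun z hz =>
      hM ‖z‖ ((le_max_left _ _).trans hz.2.le) z rfl hz.1⟩
  · rintro ⟨M, -, hM⟩
    filter_upwards [eventually_gt_atTop M] with r hr z hz hzη
    exact hM z ⟨hzη, hz ▸ hr⟩

lemma eventually_mem_cone : ∀ᶠ z in coneInfty η, z ∈ cone η :=
  eventually_inf_principal.2 (Eventually.of_forall fun _ h => h)

lemma tendsto_norm_coneInfty : Tendsto (fun z : ℂ => ‖z‖) (coneInfty η) atTop :=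
  tendsto_norm_cobounded_atTop.mono_left inf_le_left

lemma tendsto_im_coneInfty (hη : 0 < η) : Tendsto Complex.im (coneInfty η) atTop := by
  have h1 : Tendsto (fun z : ℂ => ‖z‖ / (1 + η)) (coneInfty η) atTop :=
    tendsto_norm_coneInfty.atTop_div_const (by linarith)
  refine tendsto_atTop_mono' _ ?_ h1
  filter_upwards [eventually_mem_cone] with z hz
  rw [div_le_iff₀ (by linarith), mul_comm]
  exact norm_le_of_mem_cone hz

lemma isOpen_cone : IsOpen (cone η) :=
  (isOpen_lt continuous_const Complex.continuous_im).inter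
    (isOpen_lt Complex.continuous_re.abs (continuous_const.mul Complex.continuous_im))

lemma isOpen_truncCone {M : ℝ} : IsOpen (truncCone η M) :=
  isOpen_cone.inter (isOpen_lt continuous_const continuous_norm)

/-- A point close to a point of a cone lies in a larger cone. -/
lemma mem_cone_of_norm_sub_le (hz : z ∈ cone η) (h : ‖w - z‖ ≤ z.im / 2) :
    w ∈ cone (2 * η + 2) ∧ z.im / 2 ≤ w.im := by
  have h1 := abs_le.1 ((Complex.abs_im_le_norm (w - z)).trans h)
  have h2 := abs_le.1 ((Complex.abs_re_le_norm (w - z)).trans h)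
  rw [Complex.sub_im] at h1
  rw [Complex.sub_re] at h2
  have hη := pos_of_mem_cone hz
  have h3 := abs_lt.1 hz.2
  have h4 : z.im / 2 ≤ w.im := by linarith
  have hz0 := hz.1
  refine ⟨⟨by linarith, ?_⟩, h4⟩
  have h5 : (2 * η + 2) * (z.im / 2) ≤ (2 * η + 2) * w.im := by gcongr
  rw [abs_lt]
  constructor <;> nlinarith

lemma mem_cone_mono {η' : ℝ} (h : η ≤ η') (hz : z ∈ cone η) : z ∈ cone η' :=
  ⟨hz.1, hz.2.trans_le (mul_le_mul_of_nonneg_right h hz.1.le)⟩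

/-- Above this height, the reciprocal Cauchy transform is close to the identity on `cone η`. -/
noncomputable def levelHeight (μ : Measure ℝ) (η : ℝ) : ℝ := 10 * (∫ t, |t| ∂μ) * (2 + η) + 1

lemma levelHeight_mono {η' : ℝ} (h : η ≤ η') : levelHeight μ η ≤ levelHeight μ η' := by
  have : 0 ≤ ∫ t, |t| ∂μ := integral_nonneg fun t => abs_nonneg t
  unfold levelHeight
  gcongr

lemma one_le_levelHeight (hη : 0 < η) : 1 ≤ levelHeight μ η := by
  have : 0 ≤ ∫ t, |t| ∂μ := integral_nonneg fun t => abs_nonneg t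
  have : 0 ≤ 10 * (∫ t, |t| ∂μ) * (2 + η) := by positivity
  unfold levelHeight
  linarith

lemma integral_abs_mul_le {x : ℝ} (hx : levelHeight μ η ≤ x) :
    (∫ t, |t| ∂μ) * (2 + η) ≤ x / 10 := by
  unfold levelHeight at hx
  linarith

section Inverse

variable [IsProbabilityMeasure μ]

lemma hasDerivAt_cauchyTransform (hz : 0 < z.im) :
    HasDerivAt (cauchyTransform μ) (∫ t : ℝ, -1 / (z - (t : ℂ)) ^ 2 ∂μ) z := by
  have him : ∀ w ∈ Metric.ball z (z.im / 2), z.im / 2 ≤ w.im := by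
    intro w hw
    rw [Metric.mem_ball, dist_eq_norm] at hw
    have h1 := abs_le.1 ((Complex.abs_im_le_norm (w - z)).trans hw.le)
    rw [Complex.sub_im] at h1
    linarith
  refine (hasDerivAt_integral_of_dominated_loc_of_deriv_le (μ := μ)
    (F := fun (z : ℂ) (t : ℝ) => 1 / (z - (t : ℂ)))
    (F' := fun (z : ℂ) (t : ℝ) => -1 / (z - (t : ℂ)) ^ 2)
    (bound := fun _ => 1 / (z.im / 2) ^ 2)
    (Metric.ball_mem_nhds z (half_pos hz)) ?_ (integrable_cauchyKernel hz) ?_ ?_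
    (integrable_const _) ?_).2
  · exact Eventually.of_forall fun w => Measurable.aestronglyMeasurable (by fun_prop)
  · exact Measurable.aestronglyMeasurable (by fun_prop)
  · refine ae_of_all _ fun t w hw => ?_
    rw [norm_div, norm_neg, norm_one, norm_pow]
    have := (him w hw).trans (im_le_norm_sub_ofReal w t)
    gcongr
  · refine ae_of_all _ fun t w hw => ?_
    have h0 := sub_ofReal_ne_zero ((half_pos hz).trans_le (him w hw)) t
    simpa [one_div] using ((hasDerivAt_id w).sub_const (t : ℂ)).fun_inv h0

lemma mul_cauchyTransform_sub_one (hz : 0 < z.im) :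
    z * cauchyTransform μ z - 1 = ∫ t : ℝ, (t : ℂ) / (z - t) ∂μ := by
  have h1 : (1 : ℂ) = ∫ _ : ℝ, (1 : ℂ) ∂μ := by simp
  rw [cauchyTransform, ← integral_const_mul]
  nth_rewrite 2 [h1]
  rw [← integral_sub ((integrable_cauchyKernel hz).const_mul z) (integrable_const _)]
  refine integral_congr_ae (ae_of_all _ fun t => ?_)
  have := sub_ofReal_ne_zero hz t
  field_simp
  ring

lemma norm_ofReal_div_le (hz : 0 < z.im) (t : ℝ) : ‖(t : ℂ) / (z - t)‖ ≤ |t| / z.im := by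
  rw [norm_div, Complex.norm_real, Real.norm_eq_abs]
  exact div_le_div_of_nonneg_left (abs_nonneg t) hz (im_le_norm_sub_ofReal z t)

lemma norm_mul_cauchyTransform_sub_one_le (hint : Integrable (fun t : ℝ => t) μ)
    (hz : 0 < z.im) : ‖z * cauchyTransform μ z - 1‖ ≤ (∫ t, |t| ∂μ) / z.im := by
  rw [mul_cauchyTransform_sub_one hz, ← integral_div]
  exact norm_integral_le_of_norm_le (hint.abs.div_const _)
    (ae_of_all _ fun t => norm_ofReal_div_le hz t)

lemma norm_mul_mul_integral_sub_one_le (hint : Integrable (fun t : ℝ => t) μ)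
    (hz : z ∈ cone η) (hw : w ∈ cone η) :
    ‖z * w * ∫ t : ℝ, 1 / (z - (t : ℂ)) * (1 / (w - (t : ℂ))) ∂μ - 1‖ ≤
      (∫ t, |t| ∂μ) * ((1 + η) / z.im + 1 / w.im) := by
  have h1 : (1 : ℂ) = ∫ _ : ℝ, (1 : ℂ) ∂μ := by simp
  have hprod : Integrable (fun t : ℝ => 1 / (z - (t : ℂ)) * (1 / (w - (t : ℂ)))) μ := by
    refine (integrable_cauchyKernel hz.1).mul_bdd (c := 1 / w.im)
      (Measurable.aestronglyMeasurable (by fun_prop)) (ae_of_all _ fun t => ?_)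
    rw [norm_div, norm_one]
    exact one_div_le_one_div_of_le hw.1 (im_le_norm_sub_ofReal w t)
  rw [← integral_const_mul]
  nth_rewrite 3 [h1]
  rw [← integral_sub (hprod.const_mul _) (integrable_const _), ← integral_mul_const]
  refine norm_integral_le_of_norm_le (hint.abs.mul_const _) (ae_of_all _ fun t => ?_)
  have hz0 := sub_ofReal_ne_zero hz.1 t
  have hw0 := sub_ofReal_ne_zero hw.1 t
  have e : z * w * (1 / (z - (t : ℂ)) * (1 / (w - (t : ℂ)))) - 1 =
      (t : ℂ) / (z - t) * (w / (w - t)) + (t : ℂ) / (w - t) := by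
    field_simp
    ring
  rw [e]
  have hz' := hz.1
  calc _ ≤ ‖(t : ℂ) / (z - t)‖ * ‖w / (w - t)‖ + ‖(t : ℂ) / (w - t)‖ := by
        rw [← norm_mul]; exact norm_add_le _ _
    _ ≤ |t| / z.im * (1 + η) + |t| / w.im := by
        gcongr
        · exact norm_ofReal_div_le hz.1 t
        · exact norm_div_sub_ofReal_le hw t
        · exact norm_ofReal_div_le hw.1 t
    _ = _ := by ring

/-- The difference quotient of `F` is arranged as a quotient of quantities that are all close to `1`
high up in a cone. -/
lemma recipCauchy_sub (hz : 0 < z.im) (hw : 0 < w.im) (hGz : cauchyTransform μ z ≠ 0)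
    (hGw : cauchyTransform μ w ≠ 0) :
    recipCauchy μ z - recipCauchy μ w = (z - w) *
      ((z * w * ∫ t : ℝ, 1 / (z - (t : ℂ)) * (1 / (w - (t : ℂ))) ∂μ) /
        ((z * cauchyTransform μ z) * (w * cauchyTransform μ w))) := by
  have h : cauchyTransform μ w - cauchyTransform μ z =
      (z - w) * ∫ t : ℝ, 1 / (z - (t : ℂ)) * (1 / (w - (t : ℂ))) ∂μ := by
    rw [cauchyTransform, cauchyTransform,
      ← integral_sub (integrable_cauchyKernel hw) (integrable_cauchyKernel hz),
      ← integral_const_mul]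
    refine integral_congr_ae (ae_of_all _ fun t => ?_)
    have hz0 := sub_ofReal_ne_zero hz t
    have hw0 := sub_ofReal_ne_zero hw t
    field_simp
    ring
  have hz0 : z ≠ 0 := by rintro rfl; exact lt_irrefl _ hz
  have hw0 : w ≠ 0 := by rintro rfl; exact lt_irrefl _ hw
  have e : recipCauchy μ z - recipCauchy μ w =
      (cauchyTransform μ w - cauchyTransform μ z) /
        (cauchyTransform μ z * cauchyTransform μ w) := by
    unfold recipCauchy
    field_simp
  rw [e, h]
  field_simp

lemma norm_mul_cauchyTransform_sub_one_le_tenth (hint : Integrable (fun t : ℝ => t) μ)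
    (hz : z ∈ cone η) (hL : levelHeight μ η ≤ z.im) :
    ‖z * cauchyTransform μ z - 1‖ ≤ 1 / 10 := by
  refine (norm_mul_cauchyTransform_sub_one_le hint hz.1).trans ?_
  rw [div_le_iff₀ hz.1]
  have h0 : 0 ≤ ∫ t, |t| ∂μ := integral_nonneg fun t => abs_nonneg t
  have hη := pos_of_mem_cone hz
  have := integral_abs_mul_le hL
  nlinarith [mul_nonneg h0 hη.le]

lemma nine_tenths_le_norm {x : ℂ} (h : ‖x - 1‖ ≤ 1 / 10) : 9 / 10 ≤ ‖x‖ := by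
  have := norm_sub_norm_le 1 x
  rw [norm_one, norm_sub_rev] at this
  linarith

lemma cauchyTransform_ne_zero (hint : Integrable (fun t : ℝ => t) μ)
    (hz : z ∈ cone η) (hL : levelHeight μ η ≤ z.im) : cauchyTransform μ z ≠ 0 := by
  intro h
  have := nine_tenths_le_norm (norm_mul_cauchyTransform_sub_one_le_tenth hint hz hL)
  rw [h, mul_zero, norm_zero] at this
  linarith

/-- `F - id` is a contraction high up in a cone. Injectivity, existence and continuity of the
inverse, and `F' ≠ 0`, all rest on this. -/
lemma norm_recipCauchy_sub_sub_le (hint : Integrable (fun t : ℝ => t) μ)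
    (hz : z ∈ cone η) (hzL : levelHeight μ η ≤ z.im)
    (hw : w ∈ cone η) (hwL : levelHeight μ η ≤ w.im) :
    ‖recipCauchy μ z - recipCauchy μ w - (z - w)‖ ≤ 1 / 2 * ‖z - w‖ := by
  have hη := pos_of_mem_cone hz
  have hL := one_le_levelHeight (μ := μ) hη
  have h0 : 0 ≤ ∫ t, |t| ∂μ := integral_nonneg fun t => abs_nonneg t
  rw [recipCauchy_sub hz.1 hw.1 (cauchyTransform_ne_zero hint hz hzL)
    (cauchyTransform_ne_zero hint hw hwL)]
  set Q := z * w * ∫ t : ℝ, 1 / (z - (t : ℂ)) * (1 / (w - (t : ℂ))) ∂μ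
  have hQ : ‖Q - 1‖ ≤ 1 / 10 := by
    refine (norm_mul_mul_integral_sub_one_le hint hz hw).trans ?_
    have h1 : (1 + η) / z.im + 1 / w.im ≤ (2 + η) / levelHeight μ η := by
      calc _ ≤ (1 + η) / levelHeight μ η + 1 / levelHeight μ η := by gcongr
        _ = _ := by ring
    refine (mul_le_mul_of_nonneg_left h1 h0).trans ?_
    rw [← mul_div_assoc, div_le_iff₀ (by linarith)]
    linarith [integral_abs_mul_le (μ := μ) (η := η) le_rfl]
  have hZ := norm_mul_cauchyTransform_sub_one_le_tenth hint hz hzL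
  have hW := norm_mul_cauchyTransform_sub_one_le_tenth hint hw hwL
  set Z := z * cauchyTransform μ z
  set W := w * cauchyTransform μ w
  have hZ' := nine_tenths_le_norm hZ
  have hW' := nine_tenths_le_norm hW
  have hZ0 : Z ≠ 0 := norm_pos_iff.1 (by linarith)
  have hW0 : W ≠ 0 := norm_pos_iff.1 (by linarith)
  have e : (z - w) * (Q / (Z * W)) - (z - w) = ((Q - 1) - ((Z - 1) * (W - 1) + (Z - 1) + (W - 1))) /
      (Z * W) * (z - w) := by
    field_simp
    ring
  rw [e, norm_mul, norm_div, norm_mul]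
  refine mul_le_mul_of_nonneg_right ?_ (norm_nonneg _)
  -- The numerator is at most `1/10 + 1/100 + 1/10 + 1/10 = 31/100`, so the quotient stays below
  -- `1/2`; the factor `10` in `levelHeight` is there for this.
  have hZW : 81 / 100 ≤ ‖Z‖ * ‖W‖ := by nlinarith
  rw [div_le_iff₀ (by linarith)]
  have h1 : ‖(Z - 1) * (W - 1)‖ ≤ 1 / 100 := by
    rw [norm_mul]
    nlinarith [norm_nonneg (Z - 1), norm_nonneg (W - 1)]
  have h2 := norm_add₃_le (a := (Z - 1) * (W - 1)) (b := Z - 1) (c := W - 1)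
  have h3 := norm_sub_le (Q - 1) ((Z - 1) * (W - 1) + (Z - 1) + (W - 1))
  linarith

lemma norm_recipCauchy_sub_self_le (hint : Integrable (fun t : ℝ => t) μ)
    (hz : z ∈ cone η) (hL : levelHeight μ η ≤ z.im) :
    ‖recipCauchy μ z - z‖ ≤ 2 * (1 + η) * ∫ t, |t| ∂μ := by
  have hη := pos_of_mem_cone hz
  have h0 : 0 ≤ ∫ t, |t| ∂μ := integral_nonneg fun t => abs_nonneg t
  have h9 := nine_tenths_le_norm (norm_mul_cauchyTransform_sub_one_le_tenth hint hz hL)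
  have hG := cauchyTransform_ne_zero hint hz hL
  have hz0 := ne_zero_of_mem_cone hz
  have e : recipCauchy μ z - z = -(z * (z * cauchyTransform μ z - 1)) / (z * cauchyTransform μ z) := by
    unfold recipCauchy
    field_simp
    ring
  rw [e, norm_div, norm_neg, norm_mul, div_le_iff₀ (by linarith)]
  calc ‖z‖ * ‖z * cauchyTransform μ z - 1‖
      ≤ (1 + η) * z.im * ((∫ t, |t| ∂μ) / z.im) := by
        have := norm_le_of_mem_cone hz
        have h1 := hz.1
        gcongr
        exact norm_mul_cauchyTransform_sub_one_le hint hz.1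
    _ = 2 * (1 + η) * (∫ t, |t| ∂μ) * (1 / 2) := by
        have := hz.1.ne'
        field_simp
    _ ≤ _ := by gcongr; linarith

lemma norm_recipCauchy_sub_self_le_fifth (hint : Integrable (fun t : ℝ => t) μ)
    (hz : z ∈ cone η) (hL : levelHeight μ η ≤ z.im) :
    ‖recipCauchy μ z - z‖ ≤ levelHeight μ η / 5 := by
  have hη := pos_of_mem_cone hz
  have h0 : 0 ≤ ∫ t, |t| ∂μ := integral_nonneg fun t => abs_nonneg t
  refine (norm_recipCauchy_sub_self_le hint hz hL).trans ?_
  have := integral_abs_mul_le (μ := μ) (η := η) le_rfl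
  nlinarith

lemma recipCauchy_injOn (hint : Integrable (fun t : ℝ => t) μ)
    (hz : z ∈ cone η) (hzL : levelHeight μ η ≤ z.im)
    (hw : w ∈ cone η) (hwL : levelHeight μ η ≤ w.im) (h : recipCauchy μ z = recipCauchy μ w) :
    z = w := by
  have h1 := norm_recipCauchy_sub_sub_le hint hz hzL hw hwL
  rw [h, sub_self, zero_sub, norm_neg] at h1
  have h2 : ‖z - w‖ = 0 := le_antisymm (by linarith) (norm_nonneg _)
  exact sub_eq_zero.1 (norm_eq_zero.1 h2)

/-- Banach's fixed point theorem for `w ↦ z + (w - F w)`, whose fixed points are the solutions of `F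
w = z`. The ball of radius `Im z / 2` leaves `cone η` but stays in `cone (2 * η + 2)`, at height at
least `Im z / 2`. -/
lemma exists_recipCauchy_eq (hint : Integrable (fun t : ℝ => t) μ)
    (hz : z ∈ cone η) (hL : 2 * levelHeight μ (2 * η + 2) ≤ z.im) :
    ∃ w, ‖w - z‖ ≤ z.im / 2 ∧ recipCauchy μ w = z := by
  set s := Metric.closedBall z (z.im / 2)
  have hs : ∀ w ∈ s, w ∈ cone (2 * η + 2) ∧ levelHeight μ (2 * η + 2) ≤ w.im := by
    intro w hw
    rw [Metric.mem_closedBall, dist_eq_norm] at hw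
    obtain ⟨h1, h2⟩ := mem_cone_of_norm_sub_le hz hw
    exact ⟨h1, by linarith⟩
  have hη := pos_of_mem_cone hz
  have hL1 := one_le_levelHeight (μ := μ) (η := 2 * η + 2) (by linarith)
  set T : ℂ → ℂ := fun w => z + (w - recipCauchy μ w) with hT
  have hmaps : Set.MapsTo T s s := by
    intro w hw
    obtain ⟨h1, h2⟩ := hs w hw
    rw [Metric.mem_closedBall, dist_eq_norm, hT]
    dsimp only
    rw [add_sub_cancel_left, norm_sub_rev]
    have := norm_recipCauchy_sub_self_le_fifth hint h1 h2
    linarith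
  have hcontr : ContractingWith (1 / 2) (hmaps.restrict T s s) := by
    refine ⟨by rw [← NNReal.coe_lt_coe]; norm_num, LipschitzWith.of_dist_le_mul ?_⟩
    rintro ⟨a, ha⟩ ⟨b, hb⟩
    obtain ⟨h1, h2⟩ := hs a ha
    obtain ⟨h3, h4⟩ := hs b hb
    have h5 := norm_recipCauchy_sub_sub_le hint h1 h2 h3 h4
    rw [Subtype.dist_eq, Subtype.dist_eq, dist_eq_norm, dist_eq_norm]
    simp only [Set.MapsTo.val_restrict_apply, hT]
    rw [norm_sub_rev] at h5
    have e : z + (a - recipCauchy μ a) - (z + (b - recipCauchy μ b)) =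
        a - b - (recipCauchy μ a - recipCauchy μ b) := by ring
    rw [e]
    simpa using h5
  obtain ⟨w, hws, hw, -⟩ := hcontr.exists_fixedPoint' Metric.isClosed_closedBall.isComplete hmaps
    (x := z) (Metric.mem_closedBall_self (half_pos hz.1).le) (edist_ne_top _ _)
  rw [Metric.mem_closedBall, dist_eq_norm] at hws
  refine ⟨w, hws, ?_⟩
  have h1 : z + (w - recipCauchy μ w) = w := hw
  linear_combination -h1

/-- The right inverse of the reciprocal Cauchy transform whose value at `z` is close to `z`. -/
noncomputable def nearInverse (μ : Measure ℝ) (z : ℂ) : ℂ :=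
  Classical.epsilon fun w => ‖w - z‖ ≤ z.im / 2 ∧ recipCauchy μ w = z

lemma nearInverse_spec (hint : Integrable (fun t : ℝ => t) μ)
    (hz : z ∈ cone η) (hL : 2 * levelHeight μ (2 * η + 2) ≤ z.im) :
    ‖nearInverse μ z - z‖ ≤ z.im / 2 ∧ recipCauchy μ (nearInverse μ z) = z ∧
      nearInverse μ z ∈ cone (2 * η + 2) ∧ z.im / 2 ≤ (nearInverse μ z).im := by
  obtain ⟨h1, h2⟩ := Classical.epsilon_spec (exists_recipCauchy_eq hint hz hL)
  exact ⟨h1, h2, mem_cone_of_norm_sub_le hz h1⟩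

/-- `F z` may leave the cone, and its near inverse may leave the wider one; hence the cone is
widened twice, and injectivity of `F` is used in the largest. -/
lemma nearInverse_recipCauchy (hint : Integrable (fun t : ℝ => t) μ)
    (hz : z ∈ cone η) (hL : 4 * levelHeight μ (2 * (2 * η + 2) + 2) ≤ z.im) :
    nearInverse μ (recipCauchy μ z) = z := by
  have hη := pos_of_mem_cone hz
  have hmono := levelHeight_mono (μ := μ) (by linarith : η ≤ 2 * (2 * η + 2) + 2)
  have hL1 := one_le_levelHeight (μ := μ) hη
  have h1 := norm_recipCauchy_sub_self_le_fifth hint hz (by linarith)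
  have h2 := abs_le.1 ((Complex.abs_im_le_norm _).trans h1)
  rw [Complex.sub_im] at h2
  obtain ⟨h3, -⟩ := mem_cone_of_norm_sub_le hz (w := recipCauchy μ z) (by linarith)
  obtain ⟨-, h5, h6, h7⟩ := nearInverse_spec hint h3 (by linarith)
  refine recipCauchy_injOn hint h6 (by linarith) (mem_cone_mono (by linarith) hz) (by linarith) h5

lemma norm_nearInverse_sub_le (hint : Integrable (fun t : ℝ => t) μ)
    (hz : z ∈ cone η) (hzL : 2 * levelHeight μ (2 * η + 2) ≤ z.im)
    (hw : w ∈ cone η) (hwL : 2 * levelHeight μ (2 * η + 2) ≤ w.im) :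
    ‖nearInverse μ z - nearInverse μ w‖ ≤ 2 * ‖z - w‖ := by
  obtain ⟨-, h1, h2, h3⟩ := nearInverse_spec hint hz hzL
  obtain ⟨-, h4, h5, h6⟩ := nearInverse_spec hint hw hwL
  have h7 := norm_recipCauchy_sub_sub_le hint h2 (by linarith) h5 (by linarith)
  rw [h1, h4, norm_sub_rev] at h7
  have h8 := norm_sub_norm_le (nearInverse μ z - nearInverse μ w) (z - w)
  linarith

lemma exists_hasDerivAt_recipCauchy (hint : Integrable (fun t : ℝ => t) μ)
    (hz : z ∈ cone η) (hL : levelHeight μ η < z.im) :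
    ∃ F', F' ≠ 0 ∧ HasDerivAt (recipCauchy μ) F' z := by
  have hd := (hasDerivAt_cauchyTransform (μ := μ) hz.1).fun_inv
    (cauchyTransform_ne_zero hint hz hL.le)
  have e : (fun z => (cauchyTransform μ z)⁻¹) = recipCauchy μ := by
    ext z
    rw [recipCauchy, one_div]
  rw [e] at hd
  refine ⟨_, fun h0 => ?_, hd⟩
  rw [h0] at hd
  -- If `F'` vanished, `F - id` would have derivative `-1`, contradicting its Lipschitz constant
  -- `1/2`.
  have h1 := (hd.sub (hasDerivAt_id z)).le_of_lip' (C := 1 / 2) (by norm_num) ?_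
  · norm_num at h1
  · filter_upwards [isOpen_cone.mem_nhds hz,
      (isOpen_lt continuous_const Complex.continuous_im).mem_nhds hL] with w hw hwL
    have h2 := norm_recipCauchy_sub_sub_le hint hw (le_of_lt hwL) hz hL.le
    refine le_trans (le_of_eq ?_) h2
    congr 1
    simp only [Pi.sub_apply, id]
    ring

lemma isRecipCauchyInverse_nearInverse (hint : Integrable (fun t : ℝ => t) μ) :
    IsRecipCauchyInverse μ (nearInverse μ) := by
  intro η hη
  obtain ⟨M, hM0, hM⟩ := eventually_coneInfty.1 ((tendsto_im_coneInfty hη).eventually_ge_atTop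
    (4 * levelHeight μ (2 * (2 * η + 2) + 2)))
  have hmono := levelHeight_mono (μ := μ) (by linarith : 2 * η + 2 ≤ 2 * (2 * η + 2) + 2)
  have hL1 := one_le_levelHeight (μ := μ) (by linarith : 0 < 2 * η + 2)
  have hM2 : ∀ z ∈ truncCone η M, 2 * levelHeight μ (2 * η + 2) ≤ z.im := fun z hz => by
    linarith [hM z hz]
  refine ⟨M, hM0, fun z hz => DifferentiableAt.differentiableWithinAt ?_, fun z hz => ?_,
    fun z hz => nearInverse_recipCauchy hint hz.1 (hM z hz)⟩
  · obtain ⟨-, -, h3, h4⟩ := nearInverse_spec hint hz.1 (hM2 z hz)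
    obtain ⟨F', hF', hd⟩ := exists_hasDerivAt_recipCauchy hint h3 (by linarith [hM z hz])
    have hnhds := isOpen_truncCone.mem_nhds hz
    refine (HasDerivAt.of_local_left_inverse ?_ hd hF' ?_).differentiableAt
    · rw [ContinuousAt, tendsto_iff_norm_sub_tendsto_zero]
      have hlim : Tendsto (fun w => 2 * ‖w - z‖) (𝓝 z) (𝓝 0) := by
        have : Continuous fun w : ℂ => 2 * ‖w - z‖ := by fun_prop
        simpa using this.tendsto z
      refine squeeze_zero' (Eventually.of_forall fun _ => norm_nonneg _) ?_ hlim
      filter_upwards [hnhds] with w hw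
        using norm_nearInverse_sub_le hint hw.1 (hM2 w hw) hz.1 (hM2 z hz)
    · filter_upwards [hnhds] with w hw using (nearInverse_spec hint hw.1 (hM2 w hw)).2.1
  · obtain ⟨-, h2, -, h4⟩ := nearInverse_spec hint hz.1 (hM2 z hz)
    exact ⟨(half_pos hz.1.1).trans_le h4, h2⟩

/-- Far out in a cone, the inverse of the reciprocal Cauchy transform is at bounded distance from
the identity. -/
lemma eventually_recipCauchyInverse (hint : Integrable (fun t : ℝ => t) μ) (hη : 0 < η) :
    ∀ᶠ z in coneInfty η, recipCauchyInverse μ z ∈ cone (2 * η + 2) ∧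
      recipCauchy μ (recipCauchyInverse μ z) = z ∧
      ‖recipCauchyInverse μ z - z‖ ≤ 2 * (1 + (2 * η + 2)) * ∫ t, |t| ∂μ := by
  have hex : ∃ g, IsRecipCauchyInverse μ g := ⟨_, isRecipCauchyInverse_nearInverse hint⟩
  have hg : IsRecipCauchyInverse μ (recipCauchyInverse μ) := by
    rw [recipCauchyInverse, dif_pos hex]
    exact hex.choose_spec
  obtain ⟨M, -, -, -, hM⟩ := hg (2 * η + 2) (by linarith)
  have hmono := levelHeight_mono (μ := μ) (by linarith : 2 * η + 2 ≤ 2 * (2 * η + 2) + 2)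
  filter_upwards [eventually_mem_cone, (tendsto_im_coneInfty hη).eventually_ge_atTop
    (2 * levelHeight μ (2 * η + 2)), (tendsto_im_coneInfty hη).eventually_gt_atTop (2 * M)]
    with z hz h1 h2
  obtain ⟨h3, h4, h5, h6⟩ := nearInverse_spec hint hz h1
  have h7 : M < ‖nearInverse μ z‖ := by
    have := (le_abs_self _).trans (Complex.abs_im_le_norm (nearInverse μ z))
    linarith
  -- The chosen inverse is a left inverse at `nearInverse μ z`, whose image under `F` is `z`; so the
  -- two inverses agree at `z`, and bounds for one serve the other.
  have h8 := hM _ ⟨h5, h7⟩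
  rw [h4] at h8
  rw [h8]
  refine ⟨h5, h4, ?_⟩
  have h9 := norm_recipCauchy_sub_self_le hint h5 (by linarith)
  rwa [h4, norm_sub_rev] at h9

lemma exists_continuousOn_recipCauchyInverse (hint : Integrable (fun t : ℝ => t) μ) (hη : 0 < η) :
    ∃ M, 0 < M ∧ ContinuousOn (recipCauchyInverse μ) (truncCone η M) := by
  have hex : ∃ g, IsRecipCauchyInverse μ g := ⟨_, isRecipCauchyInverse_nearInverse hint⟩
  have hg : IsRecipCauchyInverse μ (recipCauchyInverse μ) := by
    rw [recipCauchyInverse, dif_pos hex]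
    exact hex.choose_spec
  obtain ⟨M, hM0, hM, -⟩ := hg η hη
  exact ⟨M, hM0, hM.continuousOn⟩

end Inverse

end FreeTail

/-! ### Free cumulants and the comparison of `r_φ` with `r_G` -/

namespace FreeTail

section Cumulants

variable {m : ℕ → ℝ}

lemma sum_freeCumulantOf (hm : m 0 = 1) (n : ℕ) :
    ∑ s ∈ Finset.range (n + 1), freeCumulantOf m (s + 1) *
      PowerSeries.coeff (n - s) ((PowerSeries.mk m) ^ (s + 1)) = m (n + 1) := by
  rw [Finset.sum_range_succ, Nat.sub_self, freeCumulantOf, Finset.sum_range]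
  simp [hm]

open Polynomial in
/-- The free moment-cumulant formula for the truncated moment series. -/
lemma X_pow_dvd_trunc_sub (hm : m 0 = 1) (p : ℕ) :
    (X : ℝ[X]) ^ (p + 1) ∣ (PowerSeries.mk m).trunc (p + 1) - 1 -
      ∑ s ∈ Finset.range p, C (freeCumulantOf m (s + 1)) *
        (X ^ (s + 1) * (PowerSeries.mk m).trunc (p + 1) ^ (s + 1)) := by
  rw [X_pow_dvd_iff]
  intro d hd
  simp only [coeff_sub, finsetSum_coeff, coeff_C_mul, coeff_X_pow_mul', PowerSeries.coeff_trunc,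
    if_pos hd, PowerSeries.coeff_mk]
  rcases d with _ | n
  · simp [hm]
  · rw [← sum_freeCumulantOf hm n, coeff_one, if_neg (by omega), sub_zero, sub_eq_zero]
    refine (Finset.sum_subset_zero_on_sdiff (f := fun s => freeCumulantOf m (s + 1) *
      PowerSeries.coeff (n - s) ((PowerSeries.mk m) ^ (s + 1)))
      (Finset.range_subset_range.2 (by omega : n + 1 ≤ p)) (fun s hs => ?_) fun s hs => ?_)
    · rw [Finset.mem_sdiff, Finset.mem_range, Finset.mem_range] at hs
      rw [if_neg (by omega), mul_zero]
    · rw [Finset.mem_range] at hs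
      -- The coefficient in question has degree `n - s ≤ p`, so truncating the series before taking
      -- the power does not change it.
      have h1 := PowerSeries.trunc_trunc_pow (PowerSeries.mk m) (p + 1) (s + 1)
      have h2 := congrArg (fun P => Polynomial.coeff P (n - s)) h1
      simp only [PowerSeries.coeff_trunc, if_pos (by omega : n - s < p + 1)] at h2
      rw [if_pos (by omega), Nat.add_sub_add_right, ← h2, ← Polynomial.coe_pow,
        Polynomial.coeff_coe]

end Cumulants

variable {p : ℕ} {μ : Measure ℝ} {η : ℝ} {z w : ℂ}

lemma isBigO_pow_sub_pow {α : Type*} {l : Filter α} {A T : α → ℂ}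
    (hA : A =O[l] fun _ => (1 : ℝ)) (hT : T =O[l] fun _ => (1 : ℝ)) (j : ℕ) :
    (fun x => A x ^ j - T x ^ j) =O[l] fun x => A x - T x := by
  induction j with
  | zero => simpa using isBigO_zero _ _
  | succ j ih =>
    have h1 := (hA.pow j).mul (isBigO_refl (fun x => A x - T x) l).norm_right
    have h2 := ih.norm_right.mul hT
    simp only [one_pow, one_mul, mul_one] at h1 h2
    refine (h1.add h2).of_norm_right.congr_left fun x => ?_
    ring

lemma IsInClass.norm_remG_le (hμ : IsInClass p μ) (hz : z ∈ cone η) :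
    ‖remG p μ z‖ ≤ (2 + η) * ∫ t, |t ^ p| ∂μ := by
  rw [hμ.remG_eq hz.1, ← integral_const_mul]
  refine norm_integral_le_of_norm_le (hμ.integrable_pow_self.abs.const_mul _)
    (ae_of_all _ fun t => ?_)
  rw [pow_succ, mul_div_assoc, norm_mul, mul_comm, ← Complex.ofReal_pow, Complex.norm_real]
  exact mul_le_mul_of_nonneg_right (norm_ofReal_div_sub_le hz t) (norm_nonneg _)

/-- By the resolvent identity the difference has kernel `t ^ (p + 1) / ((z - t) (w - t))`;
boundedness of `t / (z - t)` leaves the moment of order `p` and a gain of `1 / Im w`. -/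
lemma IsInClass.norm_remG_sub_le (hμ : IsInClass p μ) (hz : z ∈ cone η) (hw : 0 < w.im) :
    ‖remG p μ w - remG p μ z‖ ≤ ‖w - z‖ * ((2 + η) * ∫ t, |t ^ p| ∂μ) / w.im := by
  rw [hμ.remG_eq hz.1, hμ.remG_eq hw, ← integral_sub (hμ.integrable_pow_succ_div hw)
    (hμ.integrable_pow_succ_div hz.1), ← integral_const_mul, ← integral_const_mul, ← integral_div]
  refine norm_integral_le_of_norm_le
    (((hμ.integrable_pow_self.abs.const_mul _).const_mul _).div_const _)
    (ae_of_all _ fun t => ?_)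
  have hz0 := sub_ofReal_ne_zero hz.1 t
  have hw0 := sub_ofReal_ne_zero hw t
  have e : (t : ℂ) ^ (p + 1) / (w - t) - (t : ℂ) ^ (p + 1) / (z - t) =
      -((w - z) * ((t : ℂ) / (z - t) * ((t ^ p : ℝ) : ℂ)) / (w - t)) := by
    push_cast
    field_simp
    ring
  rw [e, norm_neg, norm_div, norm_mul, norm_mul, Complex.norm_real, Real.norm_eq_abs]
  have hη := pos_of_mem_cone hz
  gcongr
  · exact norm_ofReal_div_sub_le hz t
  · exact im_le_norm_sub_ofReal w t

lemma mul_cauchyTransform_eq (hw : w ≠ 0) :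
    w * cauchyTransform μ w =
      Polynomial.aeval w⁻¹ ((PowerSeries.mk (moment μ)).trunc (p + 1)) +
        w⁻¹ ^ p * remG p μ w := by
  rw [Polynomial.aeval_def, PowerSeries.eval₂_trunc_eq_sum_range, remG, mul_sub, mul_sub,
    Finset.range_eq_Ico, Finset.sum_Ico_eq_sum_range]
  have h1 : ∑ j ∈ Finset.Icc 1 (p + 1), (moment μ (j - 1) : ℂ) * w ^ (-(j : ℤ)) =
      ∑ k ∈ Finset.range (p + 1), (moment μ k : ℂ) * (w⁻¹ ^ (k + 1)) := by
    rw [← Finset.Ico_succ_right_eq_Icc, Finset.sum_Ico_eq_sum_range]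
    refine Finset.sum_congr rfl fun k _ => ?_
    rw [Nat.add_sub_cancel_left, zpow_neg, zpow_natCast, inv_pow, add_comm 1 k]
  have h2 : w⁻¹ ^ p * w ^ (p + 1) = w := by
    rw [pow_succ, ← mul_assoc, ← mul_pow, inv_mul_cancel₀ hw, one_pow, one_mul]
  rw [h1, ← mul_assoc, ← mul_assoc, h2, Finset.mul_sum]
  have h3 : ∑ k ∈ Finset.range (p + 1), w * ((moment μ k : ℂ) * w⁻¹ ^ (k + 1)) =
      ∑ k ∈ Finset.range (p + 1 - 0), algebraMap ℝ ℂ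
        (PowerSeries.coeff (0 + k) (PowerSeries.mk (moment μ))) * w⁻¹ ^ (0 + k) := by
    refine Finset.sum_congr rfl fun k _ => ?_
    rw [zero_add, PowerSeries.coeff_mk, pow_succ]
    simp only [Complex.coe_algebraMap]
    field_simp
  rw [h3]
  ring

/-- Since `G (w) = 1 / z`, one has `w / z = w G (w)` and `1 / z = w⁻¹ (w G (w))`. Apart from the
factor `z ^ p`, `r_φ` becomes the expression annihilated by the formal moment-cumulant identity. -/
lemma remPhi_eq (hz : z ≠ 0) (hw : w ≠ 0) (hG : recipCauchy μ w = z)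
    (hwz : recipCauchyInverse μ z = w) :
    remPhi p μ z = z ^ p * (w * cauchyTransform μ w - 1 - ∑ s ∈ Finset.range p,
      (freeCumulant μ (s + 1) : ℂ) * (w⁻¹ ^ (s + 1) * (w * cauchyTransform μ w) ^ (s + 1))) := by
  have hinv : cauchyTransform μ w = z⁻¹ := by rw [← hG, recipCauchy, one_div, inv_inv]
  rw [remPhi, voiculescu, hwz, hinv, zpow_sub_one₀ hz, zpow_natCast, mul_assoc]
  congr 1
  rw [mul_sub, mul_sub, inv_mul_cancel₀ hz, Finset.mul_sum, mul_comm]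
  congr 1
  refine Finset.sum_congr rfl fun s _ => ?_
  rw [← mul_pow, inv_mul_cancel_left₀ hw, zpow_neg, zpow_natCast, pow_succ, inv_pow]
  ring

lemma IsInClass.isBigO_recipCauchyInverse_sub (hμ : IsInClass p μ) (hp : 1 ≤ p) (hη : 0 < η) :
    (fun z => recipCauchyInverse μ z - z) =O[coneInfty η] fun _ => (1 : ℝ) := by
  have := hμ.isProbabilityMeasure
  have hint : Integrable (fun t : ℝ => t) μ := by simpa using hμ.integrable_pow hp
  refine IsBigO.of_bound (2 * (1 + (2 * η + 2)) * ∫ t, |t| ∂μ) ?_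
  filter_upwards [eventually_recipCauchyInverse hint hη] with z hz
  simpa using hz.2.2

lemma IsInClass.isEquivalent_recipCauchyInverse (hμ : IsInClass p μ) (hp : 1 ≤ p) (hη : 0 < η) :
    recipCauchyInverse μ ~[coneInfty η] id := by
  refine (hμ.isBigO_recipCauchyInverse_sub hp hη).trans_isLittleO ?_
  rw [isLittleO_const_left]
  exact Or.inr tendsto_norm_coneInfty

/-- The two remainders differ by a term of order `1 / z`. -/
lemma IsInClass.isBigO_remPhi_sub_remG (hμ : IsInClass p μ) (hp : 1 ≤ p) (hη : 0 < η) :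
    (fun z => remPhi p μ z - remG p μ z) =O[coneInfty η] fun z => z⁻¹ := by
  have := hμ.isProbabilityMeasure
  have hint : Integrable (fun t : ℝ => t) μ := by simpa using hμ.integrable_pow hp
  set W := recipCauchyInverse μ with hW
  set T := (PowerSeries.mk (moment μ)).trunc (p + 1) with hT
  have hspec := eventually_recipCauchyInverse hint hη
  have hO := hμ.isBigO_recipCauchyInverse_sub hp hη
  have hXO : (fun z => (W z)⁻¹) =O[coneInfty η] fun z => z⁻¹ :=
    (hμ.isEquivalent_recipCauchyInverse hp hη).inv.isBigO
  have hz0 : Tendsto (fun z : ℂ => z⁻¹) (coneInfty η) (𝓝 0) :=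
    tendsto_inv₀_cobounded.mono_left inf_le_left
  have hX0 : Tendsto (fun z => (W z)⁻¹) (coneInfty η) (𝓝 0) := hXO.trans_tendsto hz0
  have hpolyO : ∀ P : Polynomial ℝ, (fun z => Polynomial.aeval (W z)⁻¹ P) =O[coneInfty η]
      fun _ => (1 : ℝ) := fun P =>
    ((P.continuous_aeval.tendsto 0).comp hX0).isBigO_one ℝ
  have hr : (fun z => remG p μ (W z)) =O[coneInfty η] fun _ => (1 : ℝ) := by
    refine IsBigO.of_bound ((2 + (2 * η + 2)) * ∫ t, |t ^ p| ∂μ) ?_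
    filter_upwards [hspec] with z hz
    simpa using hμ.norm_remG_le hz.1
  have hXpO : (fun z => (W z)⁻¹ ^ p) =O[coneInfty η] fun _ => (1 : ℝ) :=
    (hX0.pow p).isBigO_one ℝ
  set A : ℂ → ℂ := fun z => Polynomial.aeval (W z)⁻¹ T + (W z)⁻¹ ^ p * remG p μ (W z) with hA
  have hAO : A =O[coneInfty η] fun _ => (1 : ℝ) := by
    refine (hpolyO T).add ?_
    simpa using hXpO.mul hr
  have hAT : (fun z => A z - Polynomial.aeval (W z)⁻¹ T) =O[coneInfty η]
      fun z => ‖z⁻¹ ^ p‖ := by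
    have h1 := (hXO.pow p).norm_right.mul hr
    simp only [mul_one] at h1
    refine h1.congr_left fun z => ?_
    simp only [hA]
    ring
  have hXz : ∀ s : ℕ, (fun z => (W z)⁻¹ ^ (s + 1)) =O[coneInfty η] fun z => z⁻¹ := fun s => by
    have h1 := (hX0.pow s).isBigO_one ℂ
    simpa [pow_succ] using h1.mul hXO
  obtain ⟨Q, hQ⟩ := X_pow_dvd_trunc_sub (m := moment μ) (by simp [moment]) p
  -- In the cumulant sum, replacing `A` by the moment polynomial costs `O(z ^ (-p))`, and the
  -- accompanying power of `1 / W` improves this to `O(z ^ (-p - 1))`. What remains of the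
  -- polynomial part is a multiple of `W ^ (-p - 1)`.
  have hE : (fun z => A z - 1 - ∑ s ∈ Finset.range p,
      (freeCumulant μ (s + 1) : ℂ) * ((W z)⁻¹ ^ (s + 1) * A z ^ (s + 1)) -
        (W z)⁻¹ ^ p * remG p μ (W z)) =O[coneInfty η] fun z => z⁻¹ ^ (p + 1) := by
    have h1 : (fun z => (W z)⁻¹ ^ (p + 1) * Polynomial.aeval (W z)⁻¹ Q) =O[coneInfty η]
        fun z => z⁻¹ ^ (p + 1) := by
      have := (hXO.pow (p + 1)).norm_right.mul (hpolyO Q)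
      simp only [mul_one] at this
      exact this.of_norm_right
    have h2 : (fun z => ∑ s ∈ Finset.range p, (freeCumulant μ (s + 1) : ℂ) *
        ((W z)⁻¹ ^ (s + 1) * (A z ^ (s + 1) - Polynomial.aeval (W z)⁻¹ T ^ (s + 1))))
        =O[coneInfty η] fun z => z⁻¹ ^ (p + 1) := by
      refine IsBigO.fun_sum fun s _ => IsBigO.const_mul_left ?_ _
      have h3 := (hXz s).mul
        ((isBigO_pow_sub_pow hAO (hpolyO T) (s + 1)).trans hAT.of_norm_right)
      simpa only [← pow_succ'] using h3
    refine (h1.sub h2).congr_left fun z => ?_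
    have h4 := congrArg (Polynomial.aeval (W z)⁻¹) hQ
    simp only [map_sub, map_sum, map_mul, map_pow, map_one, Polynomial.aeval_X,
      Polynomial.aeval_C, Complex.coe_algebraMap, ← hT] at h4
    rw [← h4]
    simp only [freeCumulant, mul_sub, Finset.sum_sub_distrib]
    simp only [hA]
    ring
  have hquot : (fun z => (z * (W z)⁻¹) ^ p - 1) =O[coneInfty η] fun z => z⁻¹ := by
    have h1 : (fun z => z * (W z)⁻¹ - 1) =O[coneInfty η] fun z => z⁻¹ := by
      have h2 := hO.neg_left.mul hXO.norm_right
      simp only [one_mul] at h2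
      refine h2.of_norm_right.congr' ?_ EventuallyEq.rfl
      filter_upwards [hspec] with z hz
      have : W z ≠ 0 := ne_zero_of_mem_cone hz.1
      field_simp
      ring
    have h3 : (fun z => z * (W z)⁻¹) =O[coneInfty η] fun _ => (1 : ℝ) := by
      have := (h1.trans (hz0.isBigO_one ℝ)).add
        (isBigO_const_const (1 : ℂ) (one_ne_zero (α := ℝ)) (coneInfty η))
      simpa using this
    have h4 := isBigO_pow_sub_pow h3 (isBigO_const_const (1 : ℂ) one_ne_zero _) p
    simp only [one_pow] at h4
    exact h4.trans h1
  have hGG : (fun z => remG p μ (W z) - remG p μ z) =O[coneInfty η] fun z => z⁻¹ := by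
    have h1 : (fun z => remG p μ (W z) - remG p μ z) =O[coneInfty η]
        fun z => ‖W z - z‖ * ‖(W z)⁻¹‖ := by
      refine IsBigO.of_bound ((2 + η) * (∫ t, |t ^ p| ∂μ) * (1 + (2 * η + 2))) ?_
      filter_upwards [hspec, eventually_mem_cone] with z hz hzη
      refine (hμ.norm_remG_sub_le hzη hz.1.1).trans ?_
      have h2 := norm_le_of_mem_cone hz.1
      have h3 : 0 < ‖W z‖ := norm_pos_iff.2 (ne_zero_of_mem_cone hz.1)
      have h4 : 0 ≤ ∫ t, |t ^ p| ∂μ := integral_nonneg fun t => abs_nonneg _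
      have h5 : 0 < (W z).im := hz.1.1
      rw [norm_mul, norm_norm, norm_norm, norm_inv, div_le_iff₀ hz.1.1]
      have h6 : 1 ≤ (1 + (2 * η + 2)) * ‖W z‖⁻¹ * (W z).im := by
        rw [mul_right_comm, ← div_eq_mul_inv, le_div_iff₀ h3, one_mul]
        exact h2
      calc ‖W z - z‖ * ((2 + η) * ∫ t, |t ^ p| ∂μ)
          ≤ ‖W z - z‖ * ((2 + η) * ∫ t, |t ^ p| ∂μ) *
            ((1 + (2 * η + 2)) * ‖W z‖⁻¹ * (W z).im) :=
            le_mul_of_one_le_right (by positivity) h6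
        _ = _ := by ring
    have h2 := hO.norm_left.mul hXO.norm_norm
    simp only [one_mul] at h2
    exact (h1.trans h2).of_norm_right
  -- The three errors come from replacing `(z / W) ^ p` by `1`, from `z ^ p` times the cumulant
  -- error, and from moving the argument of `r_G` from `W` to `z`.
  have hfin := (((hquot.norm_right.mul hr).congr_right fun z => mul_one _).of_norm_right.add
    ((isBigO_refl (fun z : ℂ => z ^ p) _).mul hE |>.congr' EventuallyEq.rfl
      (g₂ := fun z : ℂ => z⁻¹) ?_)).add hGG
  · refine hfin.congr' ?_ EventuallyEq.rfl
    filter_upwards [hspec, eventually_mem_cone] with z hz hzη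
    have hwz : W z ≠ 0 := ne_zero_of_mem_cone hz.1
    rw [remPhi_eq (ne_zero_of_mem_cone hzη) hwz hz.2.1 rfl, mul_cauchyTransform_eq (p := p) hwz]
    simp only [hA, ← hT, mul_pow]
    ring
  · filter_upwards [eventually_mem_cone] with z hz
    have := ne_zero_of_mem_cone hz
    rw [pow_succ, ← mul_assoc, ← mul_pow, mul_inv_cancel₀ this, one_pow, one_mul]

end FreeTail

/-! ### Domination of `1 / z` and transfer between the conditions -/

namespace FreeTail

variable {p : ℕ} {μ : Measure ℝ} {η : ℝ} {z : ℂ}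

/-- The constants in the `O`-estimates depend on `η`, so those estimates stay inside one cone;
little-o has no such constant and passes to the supremum of filters. -/
lemma isLittleO_ntInfty {f g : ℂ → ℂ} (h : ∀ η, 0 < η → f =o[coneInfty η] g) :
    f =o[ntInfty] g := by
  rw [isLittleO_iff]
  intro c hc
  rw [ntInfty, eventually_iSup]
  intro η
  rw [eventually_iSup]
  exact fun hη => isLittleO_iff.1 (h η hη) hc

/-- On the cone `(Re z - t) ^ 2 + (Im z) ^ 2` is at most a constant times `(Im z) ^ 2 + t ^ 2`, so
the kernel of `-Im r_G (z)` dominates, up to that constant, the one on the imaginary axis at height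
`Im z`. -/
lemma IsInClass.tailTransform_le_norm_remG (hμ : IsInClass p μ) (hz : z ∈ cone η) :
    tailTransform p μ z.im ≤ (2 * η ^ 2 + 2) * ‖remG p μ z‖ := by
  have hz0 := hz.1
  have hη := pos_of_mem_cone hz
  have h1 : tailTransform p μ z.im ≤ (2 * η ^ 2 + 2) * -(remG p μ z).im := by
    rw [hμ.remG_eq hz0, ← RCLike.im_eq_complex_im, ← integral_im (hμ.integrable_pow_succ_div hz0),
      ← integral_neg, ← integral_const_mul, tailTransform]
    refine integral_mono_ae (hμ.integrable_tailKernel hz0)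
      ((hμ.integrable_pow_succ_div hz0).im.neg.const_mul _) ?_
    filter_upwards [hμ.ae_nonneg] with t ht
    have e : -(((t : ℂ) ^ (p + 1) / (z - t)).im) =
        t ^ (p + 1) * z.im / ((z.re - t) ^ 2 + z.im ^ 2) := by
      rw [← Complex.ofReal_pow, div_eq_mul_inv, Complex.im_ofReal_mul, Complex.inv_im,
        Complex.normSq_apply]
      simp only [Complex.sub_im, Complex.ofReal_im, Complex.sub_re, Complex.ofReal_re, sub_zero]
      ring
    have h2 : z.re ^ 2 ≤ η ^ 2 * z.im ^ 2 := by
      rw [← mul_pow, ← sq_abs]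
      exact pow_le_pow_left₀ (abs_nonneg _) hz.2.le 2
    have h3 : (z.re - t) ^ 2 + z.im ^ 2 ≤ (2 * η ^ 2 + 2) * (z.im ^ 2 + t ^ 2) := by
      nlinarith [sq_nonneg (z.re + t), mul_nonneg (sq_nonneg η) (sq_nonneg t), sq_nonneg z.im]
    rw [RCLike.im_eq_complex_im, e, tailKernel, ← mul_div_assoc,
      div_le_div_iff₀ (by positivity) (by positivity)]
    have h4 : 0 ≤ z.im * t ^ (p + 1) := by positivity
    calc z.im * t ^ (p + 1) * ((z.re - t) ^ 2 + z.im ^ 2)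
        ≤ z.im * t ^ (p + 1) * ((2 * η ^ 2 + 2) * (z.im ^ 2 + t ^ 2)) := by gcongr
      _ = _ := by ring
  refine h1.trans (mul_le_mul_of_nonneg_left ?_ (by positivity))
  exact (neg_le_abs _).trans (Complex.abs_im_le_norm _)

lemma IsInClass.inv_isLittleO_remG (hμ : IsInClass p μ) (hη : 0 < η) :
    (fun z : ℂ => z⁻¹) =o[coneInfty η] remG p μ := by
  have h1 := hμ.inv_isLittleO_tailTransform.comp_tendsto (tendsto_im_coneInfty hη)
  refine (IsBigO.of_bound 1 ?_ : (fun z : ℂ => z⁻¹) =O[coneInfty η]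
    ((fun y : ℝ => y⁻¹) ∘ Complex.im)).trans_isLittleO (h1.trans_isBigO
      (IsBigO.of_bound (2 * η ^ 2 + 2) ?_))
  · filter_upwards [eventually_mem_cone] with z hz
    rw [Function.comp_apply, norm_inv, one_mul, norm_inv, Real.norm_of_nonneg hz.1.le]
    exact inv_anti₀ hz.1 ((le_abs_self _).trans (Complex.abs_im_le_norm z))
  · filter_upwards [eventually_mem_cone,
      (tendsto_im_coneInfty hη).eventually hμ.eventually_tailTransform_pos] with z hz hpos
    rw [Function.comp_apply, Real.norm_of_nonneg hpos.le]
    exact hμ.tailTransform_le_norm_remG hz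

lemma IsInClass.isEquivalent_remPhi_remG (hμ : IsInClass p μ) (hp : 1 ≤ p) :
    remPhi p μ ~[ntInfty] remG p μ :=
  isLittleO_ntInfty fun _ hη =>
    (hμ.isBigO_remPhi_sub_remG hp hη).trans_isLittleO (hμ.inv_isLittleO_remG hη)

lemma IsInClass.inv_isLittleO_remPhi (hμ : IsInClass p μ) (hp : 1 ≤ p) :
    (fun z : ℂ => z⁻¹) =o[ntInfty] remPhi p μ :=
  (isLittleO_ntInfty fun _ hη => hμ.inv_isLittleO_remG hη).trans_isBigO
    (hμ.isEquivalent_remPhi_remG hp).symm.isBigO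

lemma I_mul_mem_truncCone {M y : ℝ} (hM : 0 ≤ M) (hy : M < y) :
    Complex.I * (y : ℂ) ∈ truncCone 1 M := by
  have hy0 := hM.trans_lt hy
  refine ⟨⟨by simpa using hy0, by simpa using hy0⟩, ?_⟩
  simpa [abs_of_pos hy0] using hy

lemma tendsto_I_mul : Tendsto (fun y : ℝ => Complex.I * (y : ℂ)) atTop (coneInfty 1) := by
  intro s hs
  obtain ⟨M, hM, h⟩ := eventually_coneInfty.1 hs
  exact mem_map.2 ((eventually_gt_atTop M).mono fun y hy => h _ (I_mul_mem_truncCone hM.le hy))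

lemma IsInClass.isBigO_remPhi_sub_remG_I_mul (hμ : IsInClass p μ) (hp : 1 ≤ p) :
    (fun y : ℝ => remPhi p μ (Complex.I * y) - remG p μ (Complex.I * y)) =O[atTop]
      fun y : ℝ => y⁻¹ := by
  refine ((hμ.isBigO_remPhi_sub_remG hp one_pos).comp_tendsto tendsto_I_mul).trans
    (IsBigO.of_bound 1 (Eventually.of_forall fun y => ?_))
  simp

lemma IsInClass.im_remG_eventuallyEq (hμ : IsInClass p μ) :
    (fun y : ℝ => (remG p μ (Complex.I * y)).im) =ᶠ[atTop] fun y => -tailTransform p μ y := by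
  filter_upwards [eventually_gt_atTop 0] with y hy using hμ.im_remG hy

lemma IsInClass.isEquivalent_im (hμ : IsInClass p μ) (hp : 1 ≤ p) :
    (fun y : ℝ => (remPhi p μ (Complex.I * y)).im) ~[atTop]
      fun y : ℝ => (remG p μ (Complex.I * y)).im := by
  have h1 : (fun y : ℝ => y⁻¹) =o[atTop] fun y : ℝ => (remG p μ (Complex.I * y)).im :=
    hμ.inv_isLittleO_tailTransform.neg_right.congr' EventuallyEq.rfl hμ.im_remG_eventuallyEq.symm
  refine IsBigO.trans_isLittleO ?_ h1
  refine (IsBigO.of_bound 1 (Eventually.of_forall fun y => ?_)).trans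
    (hμ.isBigO_remPhi_sub_remG_I_mul hp)
  rw [one_mul, Pi.sub_apply, ← Complex.sub_im]
  exact Complex.abs_im_le_norm _

lemma IsInClass.isEquivalent_re (hμ : IsInClass p μ) (hp : 1 ≤ p)
    (h : (fun y : ℝ => y⁻¹) =o[atTop] fun y : ℝ => (remG p μ (Complex.I * y)).re) :
    (fun y : ℝ => (remPhi p μ (Complex.I * y)).re) ~[atTop]
      fun y : ℝ => (remG p μ (Complex.I * y)).re := by
  refine IsBigO.trans_isLittleO ?_ h
  refine (IsBigO.of_bound 1 (Eventually.of_forall fun y => ?_)).trans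
    (hμ.isBigO_remPhi_sub_remG_I_mul hp)
  rw [one_mul, Pi.sub_apply, ← Complex.sub_re]
  exact Complex.abs_re_le_norm _

/-- Asymptotic equivalence carries over the limits of ratios but not measurability, which is
therefore supplied separately. -/
lemma SlowlyVarying.of_isEquivalent {f g : ℝ → ℝ} (hg : SlowlyVarying g) (h : f ~[atTop] g)
    (hf : ∃ A : ℝ, Measurable fun x : Set.Ioi A => f x) : SlowlyVarying f := by
  refine ⟨hf, fun t ht => ?_⟩
  have h1 := (h.comp_tendsto (tendsto_id.const_mul_atTop ht)).div h
  exact h1.symm.tendsto_nhds (hg.2 t ht)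

lemma measurable_im_remG [SFinite μ] :
    Measurable fun y : ℝ => (remG p μ (Complex.I * y)).im :=
  Complex.measurable_im.comp (measurable_remG.comp (by fun_prop))

lemma IsInClass.slowlyVarying_im_remG_iff (hμ : IsInClass p μ) :
    SlowlyVarying (fun y : ℝ => (remG p μ (Complex.I * y)).im) ↔
      ∀ t : ℝ, 0 < t →
        Tendsto (fun y => tailTransform p μ (t * y) / tailTransform p μ y) atTop (𝓝 1) := by
  have := hμ.isProbabilityMeasure
  rw [SlowlyVarying, RegularlyVarying,
    and_iff_right ⟨0, measurable_im_remG.comp measurable_subtype_coe⟩]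
  refine forall_congr' fun t => forall_congr' fun ht => ?_
  rw [Real.rpow_zero]
  refine tendsto_congr' ?_
  filter_upwards [eventually_gt_atTop 0] with y hy
  rw [hμ.im_remG hy, hμ.im_remG (mul_pos ht hy), neg_div_neg_eq]

lemma IsInClass.measurable_im_remPhi (hμ : IsInClass p μ) (hp : 1 ≤ p) :
    ∃ A : ℝ, Measurable fun y : Set.Ioi A => (remPhi p μ (Complex.I * (y : ℝ))).im := by
  have := hμ.isProbabilityMeasure
  have hint : Integrable (fun t : ℝ => t) μ := by simpa using hμ.integrable_pow hp
  obtain ⟨M, hM0, hM⟩ := exists_continuousOn_recipCauchyInverse hint one_pos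
  refine ⟨M, ?_⟩
  have h1 : Measurable fun y : Set.Ioi M => recipCauchyInverse μ (Complex.I * ((y : ℝ) : ℂ)) :=
    (hM.comp_continuous (by fun_prop) fun y => I_mul_mem_truncCone hM0.le y.2).measurable
  unfold remPhi voiculescu
  fun_prop

lemma IsInClass.slowlyVarying_im_remPhi_iff (hμ : IsInClass p μ) (hp : 1 ≤ p) :
    SlowlyVarying (fun y : ℝ => (remPhi p μ (Complex.I * y)).im) ↔
      SlowlyVarying (fun y : ℝ => (remG p μ (Complex.I * y)).im) := by
  have := hμ.isProbabilityMeasure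
  refine ⟨fun h => h.of_isEquivalent (hμ.isEquivalent_im hp).symm
      ⟨0, measurable_im_remG.comp measurable_subtype_coe⟩,
    fun h => h.of_isEquivalent (hμ.isEquivalent_im hp) (hμ.measurable_im_remPhi hp)⟩

lemma IsInClass.regularlyVarying_tail_iff (hμ : IsInClass p μ) (hp : 1 ≤ p) :
    RegularlyVarying (tail μ) (-(p : ℝ)) ↔
      SlowlyVarying (fun y : ℝ => (remG p μ (Complex.I * y)).im) := by
  rw [hμ.slowlyVarying_im_remG_iff]
  exact ⟨fun h t ht => hμ.tendsto_tailTransform_ratio hp h ht, hμ.regularlyVarying_tail hp⟩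

lemma IsInClass.inv_isLittleO_scaledTail (hμ : IsInClass p μ) (hp : 1 ≤ p)
    (h : RegularlyVarying (tail μ) (-(p : ℝ))) :
    (fun y : ℝ => y⁻¹) =o[atTop] scaledTail p μ := by
  refine hμ.inv_isLittleO_tailTransform.trans_isBigO (isBigO_of_div_tendsto_nhds ?_ _
    (hμ.tendsto_tailTransform_div_scaledTail hp h))
  filter_upwards [eventually_gt_atTop 0] with y hy h0
  exact absurd h0 (hμ.scaledTail_pos hy).ne'

lemma IsInClass.inv_isLittleO_re_remG (hμ : IsInClass p μ) (hp : 1 ≤ p)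
    (h : RegularlyVarying (tail μ) (-(p : ℝ))) :
    (fun y : ℝ => y⁻¹) =o[atTop] fun y : ℝ => (remG p μ (Complex.I * y)).re := by
  refine (hμ.inv_isLittleO_scaledTail hp h).trans_isBigO (IsBigO.of_bound 2 ?_)
  filter_upwards [eventually_gt_atTop 0] with y hy
  have h1 := hμ.half_pow_mul_tail_le hy
  rw [Real.norm_of_nonneg (hμ.scaledTail_pos hy).le, Real.norm_eq_abs, scaledTail]
  linarith [neg_le_abs (remG p μ (Complex.I * y)).re]

/-- The constant is read off from the Tauberian limit, applied after the Abelian half has given slow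
variation; the integral of `layerKernel` need not be computed. -/
lemma IsInClass.isEquivalent_im_remG (hμ : IsInClass p μ) (hp : 1 ≤ p)
    (h : RegularlyVarying (tail μ) (-(p : ℝ))) :
    (fun y : ℝ => (remG p μ (Complex.I * y)).im) ~[atTop]
      fun y : ℝ => -((p : ℝ) * Real.pi / 2) * (y ^ p * tail μ y) := by
  have hp0 : (0 : ℝ) < p := by exact_mod_cast hp
  have hpi := Real.pi_pos
  have h1 := hμ.tendsto_scaledTail_div_tailTransform hp
    (hμ.slowlyVarying_im_remG_iff.1 ((hμ.regularlyVarying_tail_iff hp).1 h))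
  refine IsEquivalent.symm (isEquivalent_of_tendsto_one ?_)
  have h2 := h1.const_mul ((p : ℝ) * Real.pi / 2)
  rw [show (p : ℝ) * Real.pi / 2 * (2 / (Real.pi * p)) = 1 by field_simp] at h2
  refine h2.congr' ?_
  filter_upwards [hμ.im_remG_eventuallyEq] with y hy
  rw [Pi.div_apply, hy, neg_mul, neg_div_neg_eq, scaledTail, mul_div_assoc _ (y ^ p * tail μ y)]

end FreeTail

theorem mainTheorem4 (p : ℕ) (hp : 1 ≤ p) (μ : MeasureTheory.Measure ℝ)
    (hμ : FreeTail.IsInClass p μ) :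
    List.TFAE
      [ FreeTail.RegularlyVarying (FreeTail.tail μ) (-(p : ℝ)),
        FreeTail.SlowlyVarying (fun y : ℝ => (FreeTail.remG p μ (Complex.I * y)).im),
        FreeTail.SlowlyVarying (fun y : ℝ => (FreeTail.remPhi p μ (Complex.I * y)).im) ∧
          (fun y : ℝ => y⁻¹) =o[atTop]
            (fun y : ℝ => (FreeTail.remPhi p μ (Complex.I * y)).re) ∧
          (fun z : ℂ => z⁻¹) =o[FreeTail.ntInfty] FreeTail.remPhi p μ ] ∧
    (FreeTail.RegularlyVarying (FreeTail.tail μ) (-(p : ℝ)) →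
      -- `r_G ∼ r_φ ≫ 1 / z` non-tangentially
      (FreeTail.remG p μ ~[FreeTail.ntInfty] FreeTail.remPhi p μ ∧
        (fun z : ℂ => z⁻¹) =o[FreeTail.ntInfty] FreeTail.remPhi p μ) ∧
      -- `Im r_φ (iy) ∼ Im r_G (iy) ∼ -(p π / 2) y ^ p μ (y, ∞) ≫ 1 / y`
      ((fun y : ℝ => (FreeTail.remPhi p μ (Complex.I * y)).im) ~[atTop]
          (fun y : ℝ => (FreeTail.remG p μ (Complex.I * y)).im) ∧
        (fun y : ℝ => (FreeTail.remG p μ (Complex.I * y)).im) ~[atTop]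
          (fun y : ℝ => -((p : ℝ) * Real.pi / 2) * (y ^ p * FreeTail.tail μ y)) ∧
        (fun y : ℝ => y⁻¹) =o[atTop]
          (fun y : ℝ => -((p : ℝ) * Real.pi / 2) * (y ^ p * FreeTail.tail μ y))) ∧
      -- `Re r_φ (iy) ∼ Re r_G (iy) ≫ 1 / y`
      ((fun y : ℝ => (FreeTail.remPhi p μ (Complex.I * y)).re) ~[atTop]
          (fun y : ℝ => (FreeTail.remG p μ (Complex.I * y)).re) ∧
        (fun y : ℝ => y⁻¹) =o[atTop]
          (fun y : ℝ => (FreeTail.remG p μ (Complex.I * y)).re))) := by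
  have h12 := hμ.regularlyVarying_tail_iff hp
  have hre := fun h => hμ.isEquivalent_re hp (hμ.inv_isLittleO_re_remG hp h)
  refine ⟨?_, fun h => ⟨⟨(hμ.isEquivalent_remPhi_remG hp).symm, hμ.inv_isLittleO_remPhi hp⟩,
    ⟨hμ.isEquivalent_im hp, hμ.isEquivalent_im_remG hp h, ?_⟩,
    hre h, hμ.inv_isLittleO_re_remG hp h⟩⟩
  · tfae_have 1 ↔ 2 := h12
    tfae_have 2 → 3 := fun h => ⟨(hμ.slowlyVarying_im_remPhi_iff hp).2 h,
      (hμ.inv_isLittleO_re_remG hp (h12.2 h)).trans_isBigO (hre (h12.2 h)).symm.isBigO,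
      hμ.inv_isLittleO_remPhi hp⟩
    tfae_have 3 → 2 := fun h => (hμ.slowlyVarying_im_remPhi_iff hp).1 h.1
    tfae_finish
  · refine (hμ.inv_isLittleO_scaledTail hp h).const_mul_right ?_
    have hp0 : (0 : ℝ) < p := by exact_mod_cast hp
    have hpi := Real.pi_pos
    exact neg_ne_zero.2 (by positivity)
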